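/- \textbf{Setting.} Let $G$ be a finite group and $A=A^{-1}$, $B=B^{-1}$ subsets of $G$ with $|A|=|B|=\Delta$ such that the left Cayley graph $\mathsf{Cay}(G,A)$ and the right Cayley graph $\mathsf{Cay}(G,B)$ are connected non-bipartite Ramanujan graphs (every adjacency eigenvalue $\mu\neq\pm\Delta$ satisfies $|\mu|\le 2\sqrt{\Delta-1}$). Put $V_{ij}=G\times\{ij\}$ for $i,j\in\{0,1\}$, $V_0=V_{00}\cup V_{11}$, $V_1=V_{01}\cup V_{10}$. The set $Q$ of squares consists of the sets $\{(g,00),(ag,01),(gb,10),(agb,11)\}$, $g\in G,a\in A,b\in B$; the set $Q(v)$ of squares containing a vertex $v$ is identified with $A\times B$ through $(a,b)$, and the local view at $v$ of a vector of $\mathbb F_2^Q$ is its restriction to $Q(v)$, an $A\times B$ matrix (rows indexed by $A$, columns by $B$). A local matrix is also regarded as a vector of $\mathbb F_2^Q$ that is zero outside $Q(v)$. $|\cdot|$ is the Hamming weight. Let $\delta>0$, $0<\rho<1/2$, $0<\varepsilon<1/4$, $w=\Delta^{3/2-\varepsilon}$, $\gamma=1-\varepsilon$. Let $C_A\subset\mathbb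 F_2^A$, $C_B\subset\mathbb F_2^B$ be linear codes with $0<\dim C_A\le\rho\Delta$, $\dim C_B=\Delta-\dim C_A$, such that $C_A,C_B,C_A^\perp,C_B^\perp$ have minimum distance $\ge\delta\Delta$ and such that both $C_A\otimes\mathbb F_2^B+\mathbb F_2^A\otimes C_B$ and $C_A^\perp\otimes\mathbb F_2^B+\mathbb F_2^A\otimes C_B^\perp$ are $w$-robust with $\Delta^\gamma$-resistance to puncturing. Here, for codes $C,D$ of minimum distances $d_C,d_D$, the code $C\otimes\mathbb F_2^{B}+\mathbb F_2^{A}\otimes D$ is $w$-robust if each of its words $x$ with $|x|\le w$ vanishes outside the union of at most $|x|/d_D$ rows and at most $|x|/d_C$ columns; the resistance means that this remains true, with the minimum distances of the punctured codes, when $C$ and $D$ are restricted to any $A'\subset A$, $B'\subset B$ with $|A'|=|B'|=\Delta-w'$, $w'\le\Delta^\gamma$. A \emph{decomposition} of $z\in\mathbb F_2^Q$ is a quadruple $\mathcal Z=(C_0,R_0,C_1,R_1)$ of vectors of $\mathbb F_2^Q$ with $z=C_0+R_0+C_1+R_1$ such that, on the local view at every vertex of $V_{ij}$, all columns of $C_j$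 are in $C_A$ and all rows of $R_i$ are in $C_B$. Its norm is the total number, over $i\ne j$ and $v\in V_{ij}$, of nonzero columns of $C_j$ and nonzero rows of $R_i$ on $Q(v)$. A vertex $v\in V_{ii}$ of $V_0$ is \emph{active} for $\mathcal Z$ if $R_i+C_i$ is nonzero on $Q(v)$. Let $\hat Z\in\mathbb F_2^Q$ be a current mismatch which admits a decomposition and at which the sequential decoder is \emph{stalled}: there are no $v\in V_0$, $c_v\in C_A\otimes\mathbb F_2^B$, $r_v\in\mathbb F_2^A\otimes C_B$ (placed on $Q(v)$) with $|\hat Z+c_v+r_v|<|\hat Z|$. Let $\mathcal Z=(C_0,R_0,C_1,R_1)$ be a decomposition of $\hat Z$ of minimum norm, and $S_0$ its set of active vertices. \emph{First parallel (tweaked) decoding step.} A vertex $v\in V_1$ is \emph{identified} if there are $A_0\subset A$, $B_0\subset B$ with $|A\setminus A_0|,|B\setminus B_0|\le\Delta^\gamma/2$, and $r\in\mathbb F_2^A\otimes C_B$, $c\in C_A\otimes\mathbb F_2^B$ such that, on the coordinates $A_0\times B_0$ of $Q(v)$, $\hat Z$ has weight $>w/2$, $r+c$ has weight $>w$, and $\hat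 Z+r+c$ has weight $<w/2$. In parallel at all identified vertices, each time starting from the original $\hat Z$, the decoder chooses such $r,c$, adds them to $\hat Z$ on $Q(v)$, and then adds single row codewords (of $C_B$) and single column codewords (of $C_A$) on $Q(v)$, in any order, as long as this decreases the weight on $Q(v)$. Let $(r_v,c_v)$ be the resulting total update at $v$, and $(r_v,c_v)=(0,0)$ at the vertices $v\in V_1$ that are not identified. The decoder works only with the sum $r_v+c_v$, which determines the pair up to the simultaneous addition of a tensor codeword $t_v\in C_A\otimes C_B$ to $r_v$ and to $c_v$. \textbf{Theorem.} For every $\delta>0$ there is a constant $\kappa>0$ such that for all $\rho\in(0,1/2)$ and $\varepsilon\in(0,1/4)$ and all sufficiently large $\Delta$ (depending on $\delta,\rho,\varepsilon$), in the above setting: if \[|S_0|\le\frac{\delta}{8\Delta}|V_0|,\] then, for every possible outcome $(r_v,c_v)_{v\in V_1}$ of the first parallel decoding step, one can choose $t_v\in C_A\otimes C_B$, $v\in V_1$ (with $t_v=0$ if $v$ is not identified), such that the decomposition $\mathcal Z'=(C_0',R_0',C_1',R_1')$ of the updated mismatch $\hat Z'$, obtained from $\mathcal Z$ by adding $r_v+t_v$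 to $R_i$ and $c_v+t_v$ to $C_j$ for all $v\in V_{ij}\subset V_1$, has a set $S_0'$ of active vertices satisfying \[|S_0'|\le\frac{\kappa\,|S_0|}{\Delta^{1-4\varepsilon}}.\] -/

import Mathlib

namespace QTanner

/-! ### Binary codes, tensor codes and dual tensor codes -/

section Codes

variable {α β : Type*} [Fintype α] [Fintype β] [DecidableEq α] [DecidableEq β]

/-- The dual code `C^⊥` of a binary linear code. -/
def dualCode (C : Submodule (ZMod 2) (α → ZMod 2)) : Submodule (ZMod 2) (α → ZMod 2) where
  carrier := {x | ∀ y ∈ C, x ⬝ᵥ y = 0}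
  zero_mem' := fun y _ => zero_dotProduct y
  add_mem' := by
    intro x x' hx hx' y hy
    rw [add_dotProduct, hx y hy, hx' y hy, add_zero]
  smul_mem' := by
    intro s x hx y hy
    rw [smul_dotProduct, hx y hy, smul_zero]

/-- The minimum distance of a nonzero binary linear code (and `0` for the zero code). -/
noncomputable def minDist (C : Submodule (ZMod 2) (α → ZMod 2)) : ℕ :=
  sInf {d | ∃ x ∈ C, x ≠ 0 ∧ hammingNorm x = d}

/-- The punctured code, obtained by keeping only the coordinates in `S`. -/
def puncture (C : Submodule (ZMod 2) (α → ZMod 2)) (S : Finset α) :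
    Submodule (ZMod 2) (S → ZMod 2) :=
  C.map (LinearMap.funLeft (ZMod 2) (ZMod 2) (Subtype.val : S → α))

/-- `C_A ⊗ F_2^B`: the matrices all of whose columns lie in `C_A`. -/
def columnCode (CA : Submodule (ZMod 2) (α → ZMod 2)) :
    Submodule (ZMod 2) (Matrix α β (ZMod 2)) where
  carrier := {x | ∀ b, (fun a => x a b) ∈ CA}
  zero_mem' := fun _ => CA.zero_mem
  add_mem' := fun hx hy b => CA.add_mem (hx b) (hy b)
  smul_mem' := fun s _ hx b => CA.smul_mem s (hx b)

/-- `F_2^A ⊗ C_B`: the matrices all of whose rows lie in `C_B`. -/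
def rowCode (CB : Submodule (ZMod 2) (β → ZMod 2)) :
    Submodule (ZMod 2) (Matrix α β (ZMod 2)) where
  carrier := {x | ∀ a, (fun b => x a b) ∈ CB}
  zero_mem' := fun _ => CB.zero_mem
  add_mem' := fun hx hy a => CB.add_mem (hx a) (hy a)
  smul_mem' := fun s _ hx a => CB.smul_mem s (hx a)

/-- The tensor code `C_A ⊗ C_B`. -/
def tensorCode (CA : Submodule (ZMod 2) (α → ZMod 2)) (CB : Submodule (ZMod 2) (β → ZMod 2)) :
    Submodule (ZMod 2) (Matrix α β (ZMod 2)) :=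
  columnCode CA ⊓ rowCode CB

/-- The dual tensor code `C_A ⊗ F_2^B + F_2^A ⊗ C_B`. -/
def dualTensorCode (CA : Submodule (ZMod 2) (α → ZMod 2))
    (CB : Submodule (ZMod 2) (β → ZMod 2)) : Submodule (ZMod 2) (Matrix α β (ZMod 2)) :=
  columnCode CA ⊔ rowCode CB

/-- The Hamming weight of a matrix on the coordinate set `S × T`. -/
def weightOn (S : Finset α) (T : Finset β) (x : Matrix α β (ZMod 2)) : ℕ :=
  ((S ×ˢ T).filter fun q => x q.1 q.2 ≠ 0).card

/-- The Hamming weight of a matrix. -/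
def weight (x : Matrix α β (ZMod 2)) : ℕ := weightOn Finset.univ Finset.univ x

/-- The number `‖c‖` of nonzero columns of a matrix. -/
def colNorm (c : Matrix α β (ZMod 2)) : ℕ :=
  (Finset.univ.filter fun b => (fun a => c a b) ≠ 0).card

/-- The number `‖r‖` of nonzero rows of a matrix. -/
def rowNorm (r : Matrix α β (ZMod 2)) : ℕ :=
  (Finset.univ.filter fun a => (fun b => r a b) ≠ 0).card

/-- The dual tensor code of `C_A` and `C_B` is `w`-robust: each of its codewords `x` of weight
at most `w` is supported by at most `|x| / d_B` rows and at most `|x| / d_A` columns. -/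
def Robust (w : ℝ) (CA : Submodule (ZMod 2) (α → ZMod 2))
    (CB : Submodule (ZMod 2) (β → ZMod 2)) : Prop :=
  ∀ x ∈ dualTensorCode CA CB, (weight x : ℝ) ≤ w →
    ∃ (A' : Finset α) (B' : Finset β),
      (A'.card : ℝ) ≤ (weight x : ℝ) / (minDist CB : ℝ) ∧
      (B'.card : ℝ) ≤ (weight x : ℝ) / (minDist CA : ℝ) ∧
      ∀ a b, a ∉ A' → b ∉ B' → x a b = 0

/-- The dual tensor code of `C_A` and `C_B` is `w`-robust with `p`-resistance to puncturing:
it stays `w`-robust after any puncturing of `C_A` and of `C_B` in the same number `w' ≤ p` of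
coordinates. -/
def RobustResistant (w p : ℝ) (CA : Submodule (ZMod 2) (α → ZMod 2))
    (CB : Submodule (ZMod 2) (β → ZMod 2)) : Prop :=
  ∀ (A' : Finset α) (B' : Finset β) (w' : ℕ), (w' : ℝ) ≤ p →
    A'.card + w' = Fintype.card α → B'.card + w' = Fintype.card β →
    Robust w (puncture CA A') (puncture CB B')

/-- The conditions on the two component codes of length `Δ`. -/
structure GoodCodes (Δ : ℕ) (ρ δ ε : ℝ) (CA : Submodule (ZMod 2) (α → ZMod 2))
    (CB : Submodule (ZMod 2) (β → ZMod 2)) : Prop where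
  dim_pos : 0 < Module.finrank (ZMod 2) CA
  dim_le : (Module.finrank (ZMod 2) CA : ℝ) ≤ ρ * Δ
  dim_add : Module.finrank (ZMod 2) CA + Module.finrank (ZMod 2) CB = Δ
  dist_A : δ * Δ ≤ minDist CA
  dist_B : δ * Δ ≤ minDist CB
  dist_dual_A : δ * Δ ≤ minDist (dualCode CA)
  dist_dual_B : δ * Δ ≤ minDist (dualCode CB)
  robust_one : RobustResistant ((Δ : ℝ) ^ (3 / 2 - ε)) ((Δ : ℝ) ^ (1 - ε)) CA CB
  robust_zero : RobustResistant ((Δ : ℝ) ^ (3 / 2 - ε)) ((Δ : ℝ) ^ (1 - ε))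
    (dualCode CA) (dualCode CB)

/-! ### The local (tweaked) decoder on one local view -/

/-- On the local view `z` of the mismatch, the coordinate subsets `A₀ = A ∖ A''` and
`B₀ = B ∖ B''` with `|A''|, |B''| ≤ p / 2` and the dual tensor codeword `r + c` meet the criteria
of the tweaked decoder with parameters `w` and `p`. -/
structure Identifies (w p : ℝ) (CA : Submodule (ZMod 2) (α → ZMod 2))
    (CB : Submodule (ZMod 2) (β → ZMod 2)) (z : Matrix α β (ZMod 2))
    (A₀ : Finset α) (B₀ : Finset β) (r c : Matrix α β (ZMod 2)) : Prop where
  card_A : ((A₀ᶜ).card : ℝ) ≤ p / 2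
  card_B : ((B₀ᶜ).card : ℝ) ≤ p / 2
  mem_row : r ∈ rowCode CB
  mem_col : c ∈ columnCode CA
  weight_before : w / 2 < (weightOn A₀ B₀ z : ℝ)
  weight_word : w < (weightOn A₀ B₀ (r + c) : ℝ)
  weight_after : (weightOn A₀ B₀ (z + r + c) : ℝ) < w / 2

/-- The tweaked decoder identifies the local view `z` as one that it has to update. -/
def Identified (w p : ℝ) (CA : Submodule (ZMod 2) (α → ZMod 2))
    (CB : Submodule (ZMod 2) (β → ZMod 2)) (z : Matrix α β (ZMod 2)) : Prop :=
  ∃ A₀ B₀ r c, Identifies w p CA CB z A₀ B₀ r c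

/-- One move of the second phase: a single row codeword or a single column codeword is added to
the update `(r, c)` made so far, and this decreases the weight of the mismatch on the local view,
whose original value is `z`. -/
def LineMove (CA : Submodule (ZMod 2) (α → ZMod 2)) (CB : Submodule (ZMod 2) (β → ZMod 2))
    (z : Matrix α β (ZMod 2)) (u u' : Matrix α β (ZMod 2) × Matrix α β (ZMod 2)) : Prop :=
  weight (z + u'.1 + u'.2) < weight (z + u.1 + u.2) ∧
    ((∃ a, ∃ y ∈ CB, u' = (u.1 + Matrix.of (fun a' b => if a' = a then y b else 0), u.2)) ∨
     (∃ b, ∃ y ∈ CA, u' = (u.1, u.2 + Matrix.of (fun a b' => if b' = b then y a else 0))))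

/-- `u = (r_v, c_v)` is a possible total update made by the tweaked decoder on an identified local
view `z`: first a dual tensor codeword meeting the criteria, then moves on single rows and columns
until no further such move exists. -/
def LocalOutcome (w p : ℝ) (CA : Submodule (ZMod 2) (α → ZMod 2))
    (CB : Submodule (ZMod 2) (β → ZMod 2)) (z : Matrix α β (ZMod 2))
    (u : Matrix α β (ZMod 2) × Matrix α β (ZMod 2)) : Prop :=
  (∃ A₀ B₀ r c, Identifies w p CA CB z A₀ B₀ r c ∧
    Relation.ReflTransGen (LineMove CA CB z) (r, c) u) ∧
  ∀ u', ¬ LineMove CA CB z u u'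

end Codes

/-! ### Ramanujan graphs -/

/-- A finite graph, given by its (symmetric) adjacency relation `E` in which loops are allowed and
which is regular of degree `Δ`, is a connected non-bipartite Ramanujan graph. -/
structure NonbipartiteRamanujan {V : Type*} [Fintype V] [DecidableEq V] (E : V → V → Prop)
    [DecidableRel E] (Δ : ℕ) : Prop where
  connected : ∀ x y, Relation.ReflTransGen E x y
  nonbipartite : ¬ ∃ f : V → Bool, ∀ x y, E x y → f x ≠ f y
  spectral : ∀ μ : ℝ,
    Module.End.HasEigenvalue
      (Matrix.toLin' (Matrix.of fun x y => if E x y then (1 : ℝ) else 0)) μ →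
    μ ≠ Δ → μ ≠ -Δ → |μ| ≤ 2 * Real.sqrt ((Δ : ℝ) - 1)

/-! ### The quadripartite left-right Cayley complex -/

section Complex

variable {G : Type*} [Group G] [Fintype G] [DecidableEq G]

/-- Adjacency in the left Cayley graph `Cay(G, A)`. -/
abbrev leftCay (A : Finset G) : G → G → Prop := fun g h => h * g⁻¹ ∈ A

/-- Adjacency in the right Cayley graph `Cay(G, B)`. -/
abbrev rightCay (B : Finset G) : G → G → Prop := fun g h => g⁻¹ * h ∈ B

variable (G) in
/-- The vertices: `(g, i, j)` is the vertex `(g, ij)` of `V_ij`. -/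
abbrev Vertex : Type _ := G × Fin 2 × Fin 2

variable (G) in
/-- `V₀ = V₀₀ ∪ V₁₁`. -/
def V0 : Finset (Vertex G) := Finset.univ.filter fun v => v.2.1 = v.2.2

variable (G) in
/-- `V₁ = V₀₁ ∪ V₁₀`. -/
def V1 : Finset (Vertex G) := Finset.univ.filter fun v => v.2.1 ≠ v.2.2

/-- The squares: `(g, a, b)` is the square `{(g,00), (ag,01), (gb,10), (agb,11)}`; distinct
triples give distinct squares. -/
abbrev Square (A B : Finset G) : Type _ := G × A × B

variable {A B : Finset G}

/-- The vertex of a square in `V_ij`, as an element of `G`. -/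
def corner (i j : Fin 2) (q : Square A B) : G :=
  (q.2.1 : G) ^ (j : ℕ) * q.1 * (q.2.2 : G) ^ (i : ℕ)

/-- The square labelled `(a, b)` in the `Q`-neighbourhood of the vertex `v`. -/
def label (v : Vertex G) (a : A) (b : B) : Square A B :=
  (((a : G)⁻¹) ^ (v.2.2 : ℕ) * v.1 * ((b : G)⁻¹) ^ (v.2.1 : ℕ), a, b)

/-- The local view on `Q(v)` of a vector indexed by the squares, as an `A × B` matrix. -/
def localView (v : Vertex G) (x : Square A B → ZMod 2) : Matrix A B (ZMod 2) :=
  Matrix.of fun a b => x (label v a b)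

/-- The vector indexed by the squares that has local view `m` on `Q(v)` and is `0` elsewhere. -/
def pad (v : Vertex G) (m : Matrix A B (ZMod 2)) : Square A B → ZMod 2 :=
  fun q => if corner v.2.1 v.2.2 q = v.1 then m q.2.1 q.2.2 else 0

/-- The sequential decoder with current mismatch `z` is stalled: at no vertex of `V₀` does the
addition of a local codeword `c_v + r_v` decrease the Hamming weight of `z`. -/
def Stalled (CA : Submodule (ZMod 2) (A → ZMod 2)) (CB : Submodule (ZMod 2) (B → ZMod 2))
    (z : Square A B → ZMod 2) : Prop :=
  ∀ v ∈ V0 G, ∀ c ∈ columnCode (β := B) CA, ∀ r ∈ rowCode (α := A) CB,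
    ¬ hammingNorm (z + pad v (c + r)) < hammingNorm z

/-- A quadruple of vectors `(C₀, R₀, C₁, R₁)` indexed by the squares. -/
@[ext]
structure Quadruple (A B : Finset G) where
  C : Fin 2 → Square A B → ZMod 2
  R : Fin 2 → Square A B → ZMod 2

/-- The quadruple is a decomposition (representation) of the vector `z`: on the
`Q`-neighbourhood of each vertex of `V_ij` the columns of `C_j` lie in `C_A` and the rows of `R_i`
lie in `C_B`, and `z = C₀ + R₀ + C₁ + R₁`. -/
structure Quadruple.IsDecomposition (CA : Submodule (ZMod 2) (A → ZMod 2))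
    (CB : Submodule (ZMod 2) (B → ZMod 2)) (Z : Quadruple A B) (z : Square A B → ZMod 2) :
    Prop where
  col_mem : ∀ v : Vertex G, localView v (Z.C v.2.2) ∈ columnCode (β := B) CA
  row_mem : ∀ v : Vertex G, localView v (Z.R v.2.1) ∈ rowCode (α := A) CB
  sum_eq : z = Z.C 0 + Z.R 0 + Z.C 1 + Z.R 1

/-- The norm `‖C₀‖ + ‖R₀‖ + ‖C₁‖ + ‖R₁‖`, where the nonzero columns of `C_j` and the nonzero rows
of `R_i` are counted in the local views of the vertices of `V_ij ⊆ V₁`. -/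
def Quadruple.norm (Z : Quadruple A B) : ℕ :=
  ∑ v ∈ V1 G, (colNorm (localView v (Z.C v.2.2)) + rowNorm (localView v (Z.R v.2.1)))

/-- The quadruple is a decomposition of `z` of minimum norm. -/
def Quadruple.IsMinimal (CA : Submodule (ZMod 2) (A → ZMod 2))
    (CB : Submodule (ZMod 2) (B → ZMod 2)) (Z : Quadruple A B) (z : Square A B → ZMod 2) :
    Prop :=
  Z.IsDecomposition CA CB z ∧
    ∀ Y : Quadruple A B, Y.IsDecomposition CA CB z → Z.norm ≤ Y.norm

/-- The active vertices of `V₀`: the vertices of `V_ii` on whose `Q`-neighbourhood `R_i + C_i` is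
nonzero. -/
def Quadruple.active (Z : Quadruple A B) : Finset (Vertex G) :=
  (V0 G).filter fun v => localView v (Z.R v.2.1 + Z.C v.2.2) ≠ 0

/-- The quadruple after adding, simultaneously for all vertices `v ∈ V_ij` of `V₁`, the local
vector `(u v).1 = r_v` to `R_i` and the local vector `(u v).2 = c_v` to `C_j`. -/
def Quadruple.update (Z : Quadruple A B)
    (u : Vertex G → Matrix A B (ZMod 2) × Matrix A B (ZMod 2)) : Quadruple A B where
  C := fun j => Z.C j + ∑ v ∈ (V1 G).filter (fun v => v.2.2 = j), pad v (u v).2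
  R := fun i => Z.R i + ∑ v ∈ (V1 G).filter (fun v => v.2.1 = i), pad v (u v).1

/-- `u v = (r_v, c_v)`, `v ∈ V₁`, is a possible family of updates made by the first parallel
decoding step on the mismatch `z`: all identified vertices of `V₁` are treated, independently of
each other and all from the same `z`, and nothing is done at the other vertices. -/
def FirstParallelStep (w p : ℝ) (CA : Submodule (ZMod 2) (A → ZMod 2))
    (CB : Submodule (ZMod 2) (B → ZMod 2)) (z : Square A B → ZMod 2)
    (u : Vertex G → Matrix A B (ZMod 2) × Matrix A B (ZMod 2)) : Prop :=
  ∀ v ∈ V1 G,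
    (Identified w p CA CB (localView v z) → LocalOutcome w p CA CB (localView v z) (u v)) ∧
    (¬ Identified w p CA CB (localView v z) → u v = 0)

end Complex

end QTanner

/-!
Every vertex of `V₀` and of `V₁` carries a codeword made of rows (edges with a label in `A`) and
columns (edges with a label in `B`), and each edge joins `V₀` to `V₁`. On the local view at a
vertex the mismatch is the codeword of the vertex plus *noise*, consisting of the rows of its
`B`-neighbours and the columns of its `A`-neighbours (`Quadruple.IsDecomposition.localView_eq`).
A decomposition of minimum norm is minimal at every vertex under the exchange of tensor codewords
(`Quadruple.IsMinimal.le_add`), so robustness turns a codeword of small weight, even on a slightly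
punctured rectangle, into few rows and few columns (`exists_tensor_rowNorm_colNorm_le`).

The decoder is stalled, so the codeword of an active vertex of `V₀` meets noise on half of its
support, and noise at a vertex of `V₀` comes from active opposite vertices. With the expansion of
the square graph this bounds the number of *exceptional* active vertices, those with a codeword of
weight above a small multiple of `Δ ^ (3/2 - ε)`, by `O(|S₀| / Δ ^ (1 - 2ε))`. Any other vertex
carries `O(Δ ^ (1/2 - ε))` rows and columns, each of which must meet noise on nearly half of its
support; hence each leads to a vertex of `V₁` with `Ω(Δ)` active neighbours, and there are only
`O(|S₀| / Δ)` such vertices.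

Let `v ∈ V₁` have fewer than `Δ ^ (1 - ε) / 2` exceptional neighbours of each kind. Away from the rows
and columns of these neighbours, the noise at `v` has weight at most `w / 4`
(`Setting.weightOn_noiseAt_le`). If `v` is not identified, then its own codeword is small, since
otherwise it would be a legitimate choice of the decoder. If `v` is identified, then the word chosen
by the decoder differs from the codeword of `v` by few rows and columns, up to a tensor codeword, and
the line moves preserve this and finally clear every row and column that is not very noisy
(`Confined.lineMove`, `Confined.row_eq_zero`). In both cases a surviving edge at `v` leads to an
exceptional vertex or to a vertex with `Ω(Δ)` neighbours among the `O(|S₀| / Δ)` vertices above;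
there are `O(|S₀| / Δ ^ 2)` of the latter kind.

Finally, by expansion at most `O(|S₀| / Δ ^ (2 - 4ε))` vertices have `Δ ^ (1 - ε) / 2` or more
exceptional neighbours, and each of them spoils at most `2Δ` vertices of `V₀`. This last term
dominates and gives the exponent `1 - 4ε` (`combined_bound`).
-/

set_option linter.unusedSectionVars false

namespace QTanner

open Finset Matrix

/-! ### Binary codes and punctured robustness -/

section LocalCodes

variable {ι α β : Type*} [Fintype ι] [DecidableEq ι] [Fintype α] [Fintype β] [DecidableEq α]
  [DecidableEq β]

lemma hammingNorm_eq_sum (f : ι → ZMod 2) :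
    hammingNorm f = ∑ i, if f i ≠ 0 then 1 else 0 := by
  rw [hammingNorm, card_filter]

lemma hammingNorm_add_le (f g : ι → ZMod 2) :
    hammingNorm (f + g) ≤ hammingNorm f + hammingNorm g := by
  simp only [hammingNorm_eq_sum, ← sum_add_distrib]
  refine sum_le_sum fun i _ => ?_
  rw [Pi.add_apply]
  generalize f i = x
  generalize g i = y
  revert x y
  decide

lemma hammingNorm_add_add_card (f y : ι → ZMod 2) :
    hammingNorm (f + y) + hammingNorm y =
      hammingNorm f + 2 * #{i | y i ≠ 0 ∧ f i = 0} := by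
  simp only [hammingNorm_eq_sum, card_filter, mul_sum, ← sum_add_distrib]
  refine sum_congr rfl fun i _ => ?_
  rw [Pi.add_apply]
  generalize f i = x
  generalize y i = y
  revert x y
  decide

/-- If adding `y` does not decrease the weight of `f`, then `f` vanishes on at least half of the
support of `y`. -/
lemma hammingNorm_le_two_mul_card {f y : ι → ZMod 2}
    (h : hammingNorm f ≤ hammingNorm (f + y)) :
    hammingNorm y ≤ 2 * #{i | y i ≠ 0 ∧ f i = 0} := by
  have := hammingNorm_add_add_card f y
  omega

lemma weight_eq_sum (m : Matrix α β (ZMod 2)) : weight m = ∑ a, hammingNorm (m a) := by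
  simp only [weight, weightOn, hammingNorm, card_filter, sum_product]

lemma weightOn_eq_sum (S : Finset α) (T : Finset β) (x : Matrix α β (ZMod 2)) :
    weightOn S T x = ∑ a ∈ S, ∑ b ∈ T, if x a b ≠ 0 then 1 else 0 := by
  simp only [weightOn, card_filter, sum_product]

lemma weightOn_transpose (S : Finset α) (T : Finset β) (x : Matrix α β (ZMod 2)) :
    weightOn T S xᵀ = weightOn S T x := by
  rw [weightOn_eq_sum, weightOn_eq_sum, Finset.sum_comm]
  rfl

lemma weight_transpose (m : Matrix α β (ZMod 2)) : weight mᵀ = weight m :=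
  weightOn_transpose univ univ m

lemma weight_eq_hammingNorm (m : Matrix α β (ZMod 2)) :
    weight m = hammingNorm fun q : α × β => m q.1 q.2 := by
  simp only [weight, weightOn, hammingNorm, univ_product_univ]

/-- The matrix whose row `a` is `y` and whose other rows are zero. -/
def rowMatrix (a : α) (y : β → ZMod 2) : Matrix α β (ZMod 2) :=
  Matrix.of fun a' b => if a' = a then y b else 0

/-- The matrix whose column `b` is `y` and whose other columns are zero. -/
def colMatrix (b : β) (y : α → ZMod 2) : Matrix α β (ZMod 2) :=
  Matrix.of fun a b' => if b' = b then y a else 0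

lemma rowMatrix_self (a : α) (y : β → ZMod 2) : rowMatrix a y a = y := by
  funext b; simp [rowMatrix]

lemma rowMatrix_of_ne {a a' : α} (h : a' ≠ a) (y : β → ZMod 2) : rowMatrix a y a' = 0 := by
  funext b; simp [rowMatrix, h]

lemma colMatrix_transpose (b : β) (y : α → ZMod 2) :
    (colMatrix b y : Matrix α β (ZMod 2))ᵀ = rowMatrix b y := rfl

lemma weight_add_rowMatrix (m : Matrix α β (ZMod 2)) (a : α) (y : β → ZMod 2) :
    weight (m + rowMatrix a y) + hammingNorm (m a) = weight m + hammingNorm (m a + y) := by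
  rw [weight_eq_sum, weight_eq_sum, ← add_sum_erase univ _ (mem_univ a),
    ← add_sum_erase univ (fun a => hammingNorm (m a)) (mem_univ a)]
  have h : ∑ x ∈ univ.erase a, hammingNorm ((m + rowMatrix a y) x) =
      ∑ x ∈ univ.erase a, hammingNorm (m x) := by
    refine sum_congr rfl fun x hx => ?_
    have : (m + rowMatrix a y) x = m x + rowMatrix a y x := rfl
    rw [this, rowMatrix_of_ne (ne_of_mem_erase hx), add_zero]
  have h' : (m + rowMatrix a y) a = m a + rowMatrix a y a := rfl
  rw [h, h', rowMatrix_self]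
  ring

lemma weight_add_colMatrix (m : Matrix α β (ZMod 2)) (b : β) (y : α → ZMod 2) :
    weight (m + colMatrix b y) + hammingNorm (mᵀ b) = weight m + hammingNorm (mᵀ b + y) := by
  rw [← weight_transpose (m + colMatrix b y), transpose_add, colMatrix_transpose,
    weight_add_rowMatrix, weight_transpose]

lemma rowMatrix_mem {CB : Submodule (ZMod 2) (β → ZMod 2)} (a : α) {y : β → ZMod 2}
    (hy : y ∈ CB) : rowMatrix a y ∈ rowCode (α := α) CB := by
  intro a'
  change rowMatrix a y a' ∈ CB
  by_cases h : a' = a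
  · rw [h, rowMatrix_self]; exact hy
  · rw [rowMatrix_of_ne h]; exact CB.zero_mem

lemma colMatrix_mem {CA : Submodule (ZMod 2) (α → ZMod 2)} (b : β) {y : α → ZMod 2}
    (hy : y ∈ CA) : colMatrix b y ∈ columnCode (β := β) CA :=
  rowMatrix_mem (α := β) b hy

lemma minDist_le_hammingNorm {C : Submodule (ZMod 2) (ι → ZMod 2)} {x : ι → ZMod 2}
    (hx : x ∈ C) (h0 : x ≠ 0) : minDist C ≤ hammingNorm x :=
  Nat.sInf_le ⟨x, hx, h0, rfl⟩

lemma exists_hammingNorm_eq_minDist {C : Submodule (ZMod 2) (ι → ZMod 2)}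
    (h : ∃ x ∈ C, x ≠ 0) : ∃ x ∈ C, x ≠ 0 ∧ hammingNorm x = minDist C := by
  obtain ⟨x, hx, h0⟩ := h
  exact Nat.sInf_mem (s := {d | ∃ x ∈ C, x ≠ 0 ∧ hammingNorm x = d}) ⟨_, x, hx, h0, rfl⟩

lemma exists_ne_zero_of_minDist_pos {C : Submodule (ZMod 2) (ι → ZMod 2)}
    (h : 0 < minDist C) : ∃ x ∈ C, x ≠ 0 := by
  by_contra! hc
  have : {d | ∃ x ∈ C, x ≠ 0 ∧ hammingNorm x = d} = ∅ := by
    ext d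
    simp only [Set.mem_ofPred_eq, Set.mem_empty_iff_false, iff_false]
    rintro ⟨x, hx, h0, -⟩
    exact h0 (hc x hx)
  rw [minDist, this, Nat.sInf_empty] at h
  exact lt_irrefl _ h

lemma minDist_le_card {C : Submodule (ZMod 2) (ι → ZMod 2)} : minDist C ≤ Fintype.card ι := by
  rcases Nat.eq_zero_or_pos (minDist C) with h | h
  · omega
  · obtain ⟨x, hx, h0⟩ := exists_ne_zero_of_minDist_pos h
    exact (minDist_le_hammingNorm hx h0).trans hammingNorm_le_card_fintype

lemma hammingNorm_le_card_of_vanishing {S : Finset ι} {x : ι → ZMod 2}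
    (h : ∀ i ∉ S, x i = 0) : hammingNorm x ≤ #S := by
  refine card_le_card fun i hi => ?_
  by_contra hS
  exact (mem_filter.1 hi).2 (h i hS)

lemma eq_zero_of_vanishing {C : Submodule (ZMod 2) (ι → ZMod 2)} {S : Finset ι}
    (hS : #Sᶜ < minDist C) {x : ι → ZMod 2} (hx : x ∈ C) (h : ∀ i ∈ S, x i = 0) : x = 0 := by
  by_contra h0
  have h1 := minDist_le_hammingNorm hx h0
  have h2 : hammingNorm x ≤ #Sᶜ :=
    hammingNorm_le_card_of_vanishing fun i hi => h i (by simpa using hi)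
  omega

/-- Puncturing decreases the minimum distance by at most the number of deleted coordinates. -/
lemma minDist_le_minDist_puncture {C : Submodule (ZMod 2) (ι → ZMod 2)} {S : Finset ι}
    (hS : #Sᶜ < minDist C) : minDist C ≤ minDist (puncture C S) + #Sᶜ := by
  have key : ∀ x ∈ C, x ≠ 0 → minDist C ≤ hammingNorm (fun i : S => x i) + #Sᶜ := by
    intro x hx h0
    refine (minDist_le_hammingNorm hx h0).trans ?_
    have h1 : hammingNorm (fun i : S => x i) = #(S.filter fun i => x i ≠ 0) := by
      rw [hammingNorm, card_filter, card_filter]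
      exact sum_coe_sort S fun i => if x i ≠ 0 then 1 else 0
    have h2 : (univ.filter fun i => x i ≠ 0) ⊆ (S.filter fun i => x i ≠ 0) ∪ Sᶜ := by
      intro i hi
      by_cases h : i ∈ S <;> simp_all
    rw [h1]
    exact (card_le_card h2).trans (card_union_le _ _)
  have hne : ∃ y ∈ puncture C S, y ≠ 0 := by
    obtain ⟨x, hx, h0⟩ := exists_ne_zero_of_minDist_pos (by omega : 0 < minDist C)
    refine ⟨_, Submodule.mem_map_of_mem hx, fun h => h0 (eq_zero_of_vanishing hS hx ?_)⟩
    intro i hi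
    exact congrFun h ⟨i, hi⟩
  obtain ⟨y, hy, hy0, hyd⟩ := exists_hammingNorm_eq_minDist hne
  obtain ⟨x, hx, rfl⟩ := hy
  rw [← hyd]
  refine key x hx fun h => hy0 ?_
  rw [h, map_zero]

/-- A code is determined by, and linearly recovered from, any set of coordinates that misses fewer
coordinates than the minimum distance. -/
lemma exists_recovery {C : Submodule (ZMod 2) (ι → ZMod 2)} {S : Finset ι}
    (hS : #Sᶜ < minDist C) :
    ∃ E : (ι → ZMod 2) →ₗ[ZMod 2] (ι → ZMod 2), (∀ x, E x ∈ C) ∧ (∀ x ∈ C, E x = x) ∧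
      ∀ x y, (∀ i ∈ S, x i = y i) → E x = E y := by
  let res : (ι → ZMod 2) →ₗ[ZMod 2] (S → ZMod 2) :=
    LinearMap.funLeft (ZMod 2) (ZMod 2) (Subtype.val : S → ι)
  have hinj : LinearMap.ker (res ∘ₗ C.subtype) = ⊥ := by
    rw [LinearMap.ker_eq_bot']
    rintro ⟨x, hx⟩ h
    have : x = 0 := eq_zero_of_vanishing hS hx fun i hi => congrFun h ⟨i, hi⟩
    exact Subtype.ext this
  obtain ⟨g, hg⟩ := LinearMap.exists_leftInverse_of_injective _ hinj
  refine ⟨C.subtype ∘ₗ g ∘ₗ res, fun x => (g (res x)).2, fun x hx => ?_, fun x y hxy => ?_⟩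
  · exact congrArg Subtype.val (LinearMap.congr_fun hg ⟨x, hx⟩)
  · have : res x = res y := funext fun i => hxy i i.2
    simp [this]

/-- If `r + c` vanishes on a large rectangle, then modifying `r` and `c` by a common tensor
codeword confines `r` to the rows and `c` to the columns outside the rectangle. -/
lemma exists_tensor_of_vanishing {CA : Submodule (ZMod 2) (α → ZMod 2)}
    {CB : Submodule (ZMod 2) (β → ZMod 2)} {S : Finset α} {T : Finset β}
    (hS : #Sᶜ < minDist CA) (hT : #Tᶜ < minDist CB) {r c : Matrix α β (ZMod 2)}
    (hr : r ∈ rowCode CB) (hc : c ∈ columnCode CA)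
    (h : ∀ a ∈ S, ∀ b ∈ T, (r + c) a b = 0) :
    ∃ t ∈ tensorCode CA CB, (∀ a ∈ S, (r + t) a = 0) ∧
      ∀ b ∈ T, (fun a => (c + t) a b) = 0 := by
  obtain ⟨E, hE, hEC, hES⟩ := exists_recovery hS
  -- Recovering every column of `r` from `S` takes linear combinations of the rows of `r`.
  let t : Matrix α β (ZMod 2) := Matrix.of fun a b => E (fun a' => r a' b) a
  have ht_col : t ∈ columnCode CA := fun b => hE fun a' => r a' b
  have ht_row : t ∈ rowCode CB := by
    intro a
    have : (fun b => t a b) = ∑ a', E (Pi.single a' 1) a • (fun b => r a' b) := by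
      funext b
      change E (fun a' => r a' b) a = _
      have h1 : (fun a' => r a' b) = ∑ a', r a' b • (Pi.single a' 1 : α → ZMod 2) := by
        funext x
        simp [Finset.sum_apply, Pi.single_apply]
      rw [h1, map_sum]
      simp only [map_smul, Finset.sum_apply, Pi.smul_apply, smul_eq_mul]
      exact sum_congr rfl fun a' _ => mul_comm _ _
    rw [this]
    exact CB.sum_mem fun a' _ => CB.smul_mem _ (hr a')
  have htc : ∀ b ∈ T, (fun a => t a b) = fun a => c a b := by
    intro b hb
    change E (fun a' => r a' b) = _
    rw [hES _ (fun a => c a b) fun a ha => ?_, hEC _ (hc b)]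
    have := h a ha b hb
    rw [Matrix.add_apply] at this
    exact CharTwo.add_eq_zero.1 this
  refine ⟨t, ⟨ht_col, ht_row⟩, fun a ha => ?_, fun b hb => ?_⟩
  · refine eq_zero_of_vanishing hT ((rowCode CB).add_mem hr ht_row a) fun b hb => ?_
    have h1 := h a ha b hb
    rw [Matrix.add_apply] at h1
    have h2 : t a b = c a b := congrFun (htc b hb) a
    change r a b + t a b = 0
    rw [h2, h1]
  · funext a
    change c a b + t a b = 0
    have h2 : t a b = c a b := congrFun (htc b hb) a
    rw [h2, CharTwo.add_self_eq_zero]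

lemma rowNorm_le_card {m : Matrix α β (ZMod 2)} {S : Finset α} (h : ∀ a ∉ S, m a = 0) :
    rowNorm m ≤ #S := by
  refine card_le_card fun a ha => ?_
  by_contra hS
  exact (mem_filter.1 ha).2 (h a hS)

lemma colNorm_le_card {m : Matrix α β (ZMod 2)} {T : Finset β}
    (h : ∀ b ∉ T, (fun a => m a b) = 0) : colNorm m ≤ #T :=
  rowNorm_le_card (m := mᵀ) h

lemma hammingNorm_row_le_colNorm (m : Matrix α β (ZMod 2)) (a : α) :
    hammingNorm (m a) ≤ colNorm m := by
  refine card_le_card fun b hb => ?_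
  simp only [mem_filter, mem_univ, true_and] at hb ⊢
  exact fun h => hb (congrFun h a)

lemma hammingNorm_col_le_rowNorm (m : Matrix α β (ZMod 2)) (b : β) :
    hammingNorm (mᵀ b) ≤ rowNorm m :=
  hammingNorm_row_le_colNorm mᵀ b

lemma weightOn_add_le (S : Finset α) (T : Finset β) (x y : Matrix α β (ZMod 2)) :
    weightOn S T (x + y) ≤ weightOn S T x + weightOn S T y := by
  simp only [weightOn, card_filter, ← sum_add_distrib]
  refine sum_le_sum fun q _ => ?_
  rw [Matrix.add_apply]
  generalize x q.1 q.2 = x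
  generalize y q.1 q.2 = y
  revert x y
  decide

lemma weightOn_mono {S S' : Finset α} {T T' : Finset β} (hS : S ⊆ S') (hT : T ⊆ T')
    (x : Matrix α β (ZMod 2)) : weightOn S T x ≤ weightOn S' T' x :=
  card_le_card (filter_subset_filter _ (product_subset_product hS hT))

lemma weightOn_eq_sum_rows (S : Finset α) (T : Finset β) (x : Matrix α β (ZMod 2)) :
    weightOn S T x = ∑ a ∈ S, #(T.filter fun b => x a b ≠ 0) := by
  simp only [weightOn, card_filter, sum_product]

/-- Robustness on a punctured rectangle: a dual tensor codeword `r + c` of weight at most `W ≤ w`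
on a large rectangle is, up to a tensor codeword, a sum of few rows and few columns. -/
lemma exists_tensor_rowNorm_colNorm_le {CA : Submodule (ZMod 2) (α → ZMod 2)}
    {CB : Submodule (ZMod 2) (β → ZMod 2)} {w p d q W : ℝ}
    (hrob : RobustResistant w p CA CB) (hcard : Fintype.card α = Fintype.card β)
    (hdA : d ≤ minDist CA) (hdB : d ≤ minDist CB) {S : Finset α} {T : Finset β}
    (hS : (#Sᶜ : ℝ) ≤ q) (hT : (#Tᶜ : ℝ) ≤ q) (hq : q ≤ p) (hqd : q < d)
    {r c : Matrix α β (ZMod 2)} (hr : r ∈ rowCode CB) (hc : c ∈ columnCode CA)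
    (hW : (weightOn S T (r + c) : ℝ) ≤ W) (hWw : W ≤ w) (hlt : q + W / (d - q) < d) :
    ∃ t ∈ tensorCode CA CB, (rowNorm (r + t) : ℝ) ≤ q + W / (d - q) ∧
      (colNorm (c + t) : ℝ) ≤ q + W / (d - q) := by
  -- Shrink `S` and `T` so that they miss the same number `k` of coordinates.
  obtain ⟨k, hk⟩ : ∃ k, k = max #Sᶜ #Tᶜ := ⟨_, rfl⟩
  have hkq : (k : ℝ) ≤ q := by
    rw [hk]; push_cast; exact max_le hS hT
  have hcS := card_add_card_compl S
  have hcT := card_add_card_compl T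
  have hkα : k ≤ Fintype.card α := by
    rw [hk]; exact max_le (card_le_univ _) (hcard ▸ card_le_univ _)
  obtain ⟨S₁, hS₁, hS₁c⟩ := exists_subset_card_eq (s := S) (n := Fintype.card α - k)
    (by have := le_max_left #Sᶜ #Tᶜ; omega)
  obtain ⟨T₁, hT₁, hT₁c⟩ := exists_subset_card_eq (s := T) (n := Fintype.card β - k)
    (by have := le_max_right #Sᶜ #Tᶜ; omega)
  have hS₁' : #S₁ᶜ = k := by rw [card_compl]; omega
  have hT₁' : #T₁ᶜ = k := by rw [card_compl]; omega
  have hpA : d - q ≤ minDist (puncture CA S₁) := by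
    have h1 : (#S₁ᶜ : ℝ) < minDist CA := by rw [hS₁']; linarith
    have h2 : (minDist CA : ℝ) ≤ minDist (puncture CA S₁) + #S₁ᶜ := by
      exact_mod_cast minDist_le_minDist_puncture (by exact_mod_cast h1)
    rw [hS₁'] at h2; linarith
  have hpB : d - q ≤ minDist (puncture CB T₁) := by
    have h1 : (#T₁ᶜ : ℝ) < minDist CB := by rw [hT₁']; linarith
    have h2 : (minDist CB : ℝ) ≤ minDist (puncture CB T₁) + #T₁ᶜ := by
      exact_mod_cast minDist_le_minDist_puncture (by exact_mod_cast h1)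
    rw [hT₁'] at h2; linarith
  have hdq : 0 < d - q := by linarith
  let X : Matrix S₁ T₁ (ZMod 2) := Matrix.of fun a b => (r + c) a b
  have hX : X ∈ dualTensorCode (puncture CA S₁) (puncture CB T₁) := by
    refine Submodule.mem_sup.2 ⟨Matrix.of fun a b => c a b, fun b => ?_,
      Matrix.of fun a b => r a b, fun a => ?_, ?_⟩
    · exact Submodule.mem_map.2 ⟨_, hc b, rfl⟩
    · exact Submodule.mem_map.2 ⟨_, hr a, rfl⟩
    · ext a b
      exact add_comm _ _
  have hXw : weight X ≤ weightOn S T (r + c) := by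
    refine card_le_card_of_injOn (fun q => (q.1.1, q.2.1)) ?_ ?_
    · intro q hq
      have := (mem_filter.1 hq).2
      exact mem_filter.2 ⟨mem_product.2 ⟨hS₁ q.1.2, hT₁ q.2.2⟩, this⟩
    · intro q _ q' _ h
      simp only [Prod.mk.injEq] at h
      exact Prod.ext (Subtype.ext h.1) (Subtype.ext h.2)
  have hXW : (weight X : ℝ) ≤ W := le_trans (by exact_mod_cast hXw) hW
  obtain ⟨A', B', hA', hB', hzero⟩ := hrob S₁ T₁ k (hkq.trans hq) (by omega) (by omega) X hX
    (hXW.trans hWw)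
  have hA'' : (#A' : ℝ) ≤ W / (d - q) :=
    hA'.trans (div_le_div₀ ((Nat.cast_nonneg _).trans hXW) hXW hdq hpB)
  have hB'' : (#B' : ℝ) ≤ W / (d - q) :=
    hB'.trans (div_le_div₀ ((Nat.cast_nonneg _).trans hXW) hXW hdq hpA)
  let S₂ : Finset α := (S₁ᶜ ∪ A'.map (Function.Embedding.subtype _))ᶜ
  let T₂ : Finset β := (T₁ᶜ ∪ B'.map (Function.Embedding.subtype _))ᶜ
  have hS₂ : (#S₂ᶜ : ℝ) ≤ q + W / (d - q) := by
    have : #S₂ᶜ ≤ k + #A' := by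
      rw [compl_compl, ← hS₁', ← card_map (Function.Embedding.subtype (· ∈ S₁)) (s := A')]
      exact card_union_le _ _
    have : (#S₂ᶜ : ℝ) ≤ k + #A' := by exact_mod_cast this
    linarith
  have hT₂ : (#T₂ᶜ : ℝ) ≤ q + W / (d - q) := by
    have : #T₂ᶜ ≤ k + #B' := by
      rw [compl_compl, ← hT₁', ← card_map (Function.Embedding.subtype (· ∈ T₁)) (s := B')]
      exact card_union_le _ _
    have : (#T₂ᶜ : ℝ) ≤ k + #B' := by exact_mod_cast this
    linarith
  have hmemS : ∀ a ∈ S₂, ∃ h : a ∈ S₁, (⟨a, h⟩ : S₁) ∉ A' := by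
    intro a ha
    simp only [S₂, mem_compl, mem_union, mem_map, Function.Embedding.subtype_apply, not_or,
      not_not] at ha
    exact ⟨ha.1, fun h => ha.2 ⟨_, h, rfl⟩⟩
  have hmemT : ∀ b ∈ T₂, ∃ h : b ∈ T₁, (⟨b, h⟩ : T₁) ∉ B' := by
    intro b hb
    simp only [T₂, mem_compl, mem_union, mem_map, Function.Embedding.subtype_apply, not_or,
      not_not] at hb
    exact ⟨hb.1, fun h => hb.2 ⟨_, h, rfl⟩⟩
  obtain ⟨t, ht, h1, h2⟩ := exists_tensor_of_vanishing (S := S₂) (T := T₂)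
    (by have : (#S₂ᶜ : ℝ) < minDist CA := by linarith
        exact_mod_cast this)
    (by have : (#T₂ᶜ : ℝ) < minDist CB := by linarith
        exact_mod_cast this) hr hc (fun a ha b hb => by
      obtain ⟨ha1, ha2⟩ := hmemS a ha
      obtain ⟨hb1, hb2⟩ := hmemT b hb
      exact hzero ⟨a, ha1⟩ ⟨b, hb1⟩ ha2 hb2)
  refine ⟨t, ht, le_trans ?_ hS₂, le_trans ?_ hT₂⟩
  · exact_mod_cast rowNorm_le_card fun a ha => h1 a (by simpa using ha)
  · exact_mod_cast colNorm_le_card fun b hb => h2 b (by simpa using hb)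

end LocalCodes

/-! ### Line moves on one local view -/

section LineMoves

variable {α β : Type*} [Fintype α] [Fintype β] [DecidableEq α] [DecidableEq β]
  {CA : Submodule (ZMod 2) (α → ZMod 2)} {CB : Submodule (ZMod 2) (β → ZMod 2)}

lemma hammingNorm_add_row_le (N χ : Matrix α β (ZMod 2)) (a : α) :
    hammingNorm (N a + χ a) ≤ hammingNorm (N a) + colNorm χ :=
  (hammingNorm_add_le _ _).trans (Nat.add_le_add_left (hammingNorm_row_le_colNorm χ a) _)

/-- On a row that carries no codeword and little noise, adding a codeword does not decrease the
weight. -/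
lemma weight_le_weight_add_rowMatrix {N ρ χ : Matrix α β (ZMod 2)} {a : α} (hρ : ρ a = 0)
    (h : 2 * (hammingNorm (N a) + colNorm χ) ≤ minDist CB) {y : β → ZMod 2} (hy : y ∈ CB) :
    weight (N + ρ + χ) ≤ weight (N + (ρ + rowMatrix a y) + χ) := by
  have hrw : N + (ρ + rowMatrix a y) + χ = N + ρ + χ + rowMatrix a y := by abel
  rw [hrw]
  have h1 := weight_add_rowMatrix (N + ρ + χ) a y
  have hrow : (N + ρ + χ) a = N a + χ a := by
    change N a + ρ a + χ a = _
    rw [hρ, add_zero]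
  rw [hrow] at h1
  have h2 := hammingNorm_add_row_le N χ a
  rcases eq_or_ne y 0 with rfl | hy0
  · rw [add_zero] at h1; omega
  have h3 := minDist_le_hammingNorm hy hy0
  have h4 := hammingNorm_add_le (N a + χ a + y) (N a + χ a)
  have h5 : N a + χ a + y + (N a + χ a) = y := by
    rw [add_right_comm, ZModModule.add_self, zero_add]
  rw [h5] at h4
  omega

/-- On a row that carries a nonzero codeword and little noise, removing that codeword decreases
the weight. -/
lemma weight_add_rowMatrix_lt {N ρ χ : Matrix α β (ZMod 2)} {a : α} (hρ : ρ a ≠ 0)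
    (hρC : ρ a ∈ CB) (h : 2 * (hammingNorm (N a) + colNorm χ) < minDist CB) :
    weight (N + (ρ + rowMatrix a (ρ a)) + χ) < weight (N + ρ + χ) := by
  have hrw : N + (ρ + rowMatrix a (ρ a)) + χ = N + ρ + χ + rowMatrix a (ρ a) := by abel
  rw [hrw]
  have h1 := weight_add_rowMatrix (N + ρ + χ) a (ρ a)
  have hrow : (N + ρ + χ) a + ρ a = N a + χ a := by
    change N a + ρ a + χ a + ρ a = _
    rw [add_right_comm, add_assoc (N a), ZModModule.add_self, add_zero]
  have h2 := hammingNorm_add_row_le N χ a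
  have h3 := minDist_le_hammingNorm hρC hρ
  have h4 := hammingNorm_add_le (N a + χ a) ((N + ρ + χ) a)
  have h5 : N a + χ a + (N + ρ + χ) a = ρ a := by
    rw [← hrow, add_right_comm, ZModModule.add_self, zero_add]
  rw [h5] at h4
  rw [hrow] at h1
  omega

lemma LineMove.transpose {z : Matrix α β (ZMod 2)}
    {u u' : Matrix α β (ZMod 2) × Matrix α β (ZMod 2)} (h : LineMove CA CB z u u') :
    LineMove CB CA zᵀ (u.2ᵀ, u.1ᵀ) (u'.2ᵀ, u'.1ᵀ) := by
  obtain ⟨hw, h⟩ := h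
  refine ⟨?_, ?_⟩
  · have e : ∀ x y : Matrix α β (ZMod 2), zᵀ + yᵀ + xᵀ = (z + x + y)ᵀ := by
      intro x y
      rw [transpose_add, transpose_add, add_right_comm]
    simp only [e, weight_transpose]
    exact hw
  · rcases h with ⟨a, y, hy, rfl⟩ | ⟨b, y, hy, rfl⟩
    · exact Or.inr ⟨a, y, hy, rfl⟩
    · exact Or.inl ⟨b, y, hy, rfl⟩

/-- Line moves are insensitive to transferring a part of the mismatch into the update. -/
lemma LineMove.shift {z N x y : Matrix α β (ZMod 2)} (hz : z = N + x + y)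
    {u u' : Matrix α β (ZMod 2) × Matrix α β (ZMod 2)} (h : LineMove CA CB z u u') :
    LineMove CA CB N (x + u.1, y + u.2) (x + u'.1, y + u'.2) := by
  obtain ⟨hw, h⟩ := h
  have e : ∀ p q : Matrix α β (ZMod 2), N + (x + p) + (y + q) = z + p + q := by
    intro p q; rw [hz]; abel
  refine ⟨by simpa only [e] using hw, ?_⟩
  rcases h with ⟨a, y, hy, rfl⟩ | ⟨b, y, hy, rfl⟩
  · exact Or.inl ⟨a, y, hy, by simp only [add_assoc]⟩
  · exact Or.inr ⟨b, y, hy, by simp only [add_assoc]⟩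

/-- The invariant of the line moves: row codewords stay confined to the rows of `K` and column
codewords to the columns of `L`. -/
structure Confined (CA : Submodule (ZMod 2) (α → ZMod 2)) (CB : Submodule (ZMod 2) (β → ZMod 2))
    (K : Finset α) (L : Finset β) (u : Matrix α β (ZMod 2) × Matrix α β (ZMod 2)) : Prop where
  row_mem : u.1 ∈ rowCode CB
  col_mem : u.2 ∈ columnCode CA
  row_zero : ∀ a ∉ K, u.1 a = 0
  col_zero : ∀ b ∉ L, u.2ᵀ b = 0

lemma Confined.transpose {K : Finset α} {L : Finset β}
    {u : Matrix α β (ZMod 2) × Matrix α β (ZMod 2)} (h : Confined CA CB K L u) :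
    Confined CB CA L K (u.2ᵀ, u.1ᵀ) :=
  ⟨h.col_mem, h.row_mem, h.col_zero, h.row_zero⟩

/-- `N` has little noise on each row outside `K` and on each column outside `L`, relative to the
minimum distances of the codes. -/
structure LightOutside (CA : Submodule (ZMod 2) (α → ZMod 2))
    (CB : Submodule (ZMod 2) (β → ZMod 2)) (K : Finset α) (L : Finset β)
    (N : Matrix α β (ZMod 2)) : Prop where
  row : ∀ a ∉ K, 2 * (hammingNorm (N a) + #L) ≤ minDist CB
  col : ∀ b ∉ L, 2 * (hammingNorm (Nᵀ b) + #K) ≤ minDist CA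

lemma LightOutside.transpose {K : Finset α} {L : Finset β} {N : Matrix α β (ZMod 2)}
    (h : LightOutside CA CB K L N) : LightOutside CB CA L K Nᵀ :=
  ⟨h.col, h.row⟩

lemma Confined.colNorm_le {K : Finset α} {L : Finset β}
    {u : Matrix α β (ZMod 2) × Matrix α β (ZMod 2)} (h : Confined CA CB K L u) :
    colNorm u.2 ≤ #L :=
  colNorm_le_card h.col_zero

lemma Confined.add_rowMatrix {K : Finset α} {L : Finset β} {N : Matrix α β (ZMod 2)}
    (hN : LightOutside CA CB K L N) {r c : Matrix α β (ZMod 2)}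
    (hu : Confined CA CB K L (r, c)) {a : α} {y : β → ZMod 2} (hy : y ∈ CB)
    (hw : weight (N + (r + rowMatrix a y) + c) < weight (N + r + c)) :
    Confined CA CB K L (r + rowMatrix a y, c) := by
  have haK : a ∈ K := by
    by_contra ha
    have h1 := hN.row a ha
    have h2 := hu.colNorm_le
    exact absurd hw (not_lt.2 (weight_le_weight_add_rowMatrix (hu.row_zero a ha)
      (le_trans (by dsimp only at h2; omega) h1) hy))
  refine ⟨(rowCode CB).add_mem hu.row_mem (rowMatrix_mem a hy), hu.col_mem, fun a' ha' => ?_,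
    hu.col_zero⟩
  change r a' + rowMatrix a y a' = 0
  rw [rowMatrix_of_ne (fun h : a' = a => ha' (h ▸ haK)), add_zero]
  exact hu.row_zero a' ha'

lemma Confined.lineMove {K : Finset α} {L : Finset β} {N : Matrix α β (ZMod 2)}
    (hN : LightOutside CA CB K L N) {u u' : Matrix α β (ZMod 2) × Matrix α β (ZMod 2)}
    (hu : Confined CA CB K L u) (h : LineMove CA CB N u u') : Confined CA CB K L u' := by
  have hT := h.transpose
  obtain ⟨hw, ⟨a, y, hy, rfl⟩ | ⟨b, y, hy, rfl⟩⟩ := h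
  · exact Confined.add_rowMatrix hN hu hy hw
  · exact (Confined.add_rowMatrix hN.transpose hu.transpose hy hT.1).transpose

lemma Confined.reflTransGen {K : Finset α} {L : Finset β} {N : Matrix α β (ZMod 2)}
    (hN : LightOutside CA CB K L N) {u u' : Matrix α β (ZMod 2) × Matrix α β (ZMod 2)}
    (hu : Confined CA CB K L u) (h : Relation.ReflTransGen (LineMove CA CB N) u u') :
    Confined CA CB K L u' := by
  induction h with
  | refl => exact hu
  | tail _ h ih => exact ih.lineMove hN h

/-- When no line move is left, every surviving row codeword lies on a noisy row. -/
lemma Confined.row_eq_zero {K : Finset α} {L : Finset β} {N : Matrix α β (ZMod 2)}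
    {u : Matrix α β (ZMod 2) × Matrix α β (ZMod 2)} (hu : Confined CA CB K L u)
    (hend : ∀ u', ¬ LineMove CA CB N u u') {a : α}
    (ha : 2 * (hammingNorm (N a) + #L) < minDist CB) : u.1 a = 0 := by
  by_contra h0
  refine hend (u.1 + rowMatrix a (u.1 a), u.2) ⟨?_, Or.inl ⟨a, u.1 a, hu.row_mem a, rfl⟩⟩
  refine weight_add_rowMatrix_lt h0 (hu.row_mem a) (lt_of_le_of_lt ?_ ha)
  exact Nat.mul_le_mul_left 2 (Nat.add_le_add_left hu.colNorm_le _)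

lemma Confined.col_eq_zero {K : Finset α} {L : Finset β} {N : Matrix α β (ZMod 2)}
    {u : Matrix α β (ZMod 2) × Matrix α β (ZMod 2)} (hu : Confined CA CB K L u)
    (hend : ∀ u', ¬ LineMove CA CB N u u') {b : β}
    (hb : 2 * (hammingNorm (Nᵀ b) + #K) < minDist CA) : u.2ᵀ b = 0 :=
  hu.transpose.row_eq_zero (N := Nᵀ) (fun _ h => hend _ h.transpose) hb

end LineMoves

/-! ### Expansion of Ramanujan graphs -/

section Spectral

variable {V : Type*} [Fintype V] [DecidableEq V]

/-- The square of the Euclidean norm of a function on a finite set. -/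
def sqNorm (f : V → ℝ) : ℝ := ∑ x, f x ^ 2

/-- Quadratic form identity behind the extremal eigenvalues of a `k`-regular graph. -/
lemma sum_adj_mul_sq {M : Matrix V V ℝ} {k : ℝ} (hsymm : Mᵀ = M) (hreg : ∀ x, ∑ y, M x y = k)
    (f : V → ℝ) (s : ℝ) (hs : s ^ 2 = 1) :
    ∑ x, ∑ y, M x y * (f x - s * f y) ^ 2 = 2 * (k * sqNorm f - s * ∑ x, f x * (M *ᵥ f) x) := by
  have hs' : ∀ x y, M x y = M y x := fun x y => congrFun (congrFun hsymm.symm x) y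
  have h1 : ∑ x, ∑ y, M x y * f x ^ 2 = k * sqNorm f := by
    simp only [sqNorm, mul_sum]
    refine sum_congr rfl fun x _ => ?_
    rw [← sum_mul, hreg]
  have h2 : ∑ x, ∑ y, M x y * f y ^ 2 = k * sqNorm f := by
    rw [Finset.sum_comm, ← h1]
    exact sum_congr rfl fun x _ => sum_congr rfl fun y _ => by rw [hs']
  have h3 : ∑ x, ∑ y, M x y * (f x * f y) = ∑ x, f x * (M *ᵥ f) x := by
    refine sum_congr rfl fun x _ => ?_
    rw [mulVec, dotProduct, mul_sum]
    exact sum_congr rfl fun y _ => by ring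
  have h4 : ∀ x y, M x y * (f x - s * f y) ^ 2 =
      M x y * f x ^ 2 + M x y * f y ^ 2 - 2 * s * (M x y * (f x * f y)) := by
    intro x y
    linear_combination M x y * f y ^ 2 * hs
  simp only [h4, sum_sub_distrib, sum_add_distrib, ← mul_sum, h1, h2, h3]
  ring

/-- An eigenfunction for the extremal eigenvalue `s * k`, `s = ± 1`, is multiplied by `s` along
every edge. -/
lemma eq_mul_of_eigen {M : Matrix V V ℝ} {k : ℝ} (hsymm : Mᵀ = M) (hreg : ∀ x, ∑ y, M x y = k)
    (hpos : ∀ x y, 0 ≤ M x y) {f : V → ℝ} {s : ℝ} (hs : s ^ 2 = 1)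
    (hf : M *ᵥ f = (s * k) • f) {x y : V} (hxy : 0 < M x y) : f x = s * f y := by
  have h := sum_adj_mul_sq hsymm hreg f s hs
  have h0 : ∑ x, ∑ y, M x y * (f x - s * f y) ^ 2 = 0 := by
    rw [h, hf]
    have : ∑ x, f x * ((s * k) • f) x = s * k * sqNorm f := by
      simp only [sqNorm, mul_sum, Pi.smul_apply, smul_eq_mul]
      exact sum_congr rfl fun x _ => by ring
    rw [this]
    linear_combination -2 * k * sqNorm f * hs
  have hnn : ∀ x y, 0 ≤ M x y * (f x - s * f y) ^ 2 := fun x y =>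
    mul_nonneg (hpos x y) (sq_nonneg _)
  have h1 := (sum_eq_zero_iff_of_nonneg fun x _ => sum_nonneg fun y _ => hnn x y).1 h0 x
    (mem_univ x)
  have h2 := (sum_eq_zero_iff_of_nonneg fun y _ => hnn x y).1 h1 y (mem_univ y)
  have h3 : (f x - s * f y) ^ 2 = 0 := by
    rcases mul_eq_zero.1 h2 with h | h
    · exact absurd h hxy.ne'
    · exact h
  linarith [pow_eq_zero_iff (two_ne_zero) |>.1 h3]

/-- The adjacency operator of a connected non-bipartite Ramanujan graph contracts the functions
of mean zero: `‖M f‖² ≤ 4 Δ ‖f‖²`. -/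
lemma NonbipartiteRamanujan.sqNorm_mulVec_le {E : V → V → Prop} [DecidableRel E] {Δ : ℕ}
    (h : NonbipartiteRamanujan E Δ) (hE : ∀ x y, E x y → E y x)
    (hdeg : ∀ x, #{y | E x y} = Δ) {f : V → ℝ} (hf : ∑ x, f x = 0) :
    sqNorm ((Matrix.of fun x y => if E x y then (1 : ℝ) else 0) *ᵥ f) ≤ 4 * Δ * sqNorm f := by
  set M : Matrix V V ℝ := Matrix.of fun x y => if E x y then (1 : ℝ) else 0 with hM
  have hsymm : Mᵀ = M := by
    ext x y
    have : E y x ↔ E x y := ⟨hE y x, hE x y⟩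
    simp [hM, this]
  have hreg : ∀ x, ∑ y, M x y = (Δ : ℝ) := by
    intro x
    simp [hM, ← hdeg x]
  have hpos : ∀ x y, 0 ≤ M x y := by
    intro x y
    simp only [hM, Matrix.of_apply]
    split_ifs <;> norm_num
  have hMpos : ∀ x y, E x y → 0 < M x y := by
    intro x y hxy
    simp [hM, hxy]
  have hherm : M.IsHermitian := by
    rw [Matrix.IsHermitian, conjTranspose_eq_transpose_of_trivial, hsymm]
  let e := hherm.eigenvectorBasis
  have heig : ∀ i, M *ᵥ ⇑(e i) = hherm.eigenvalues i • ⇑(e i) := fun i =>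
    hherm.mulVec_eigenvectorBasis i
  -- coefficients of `f` and of `M f` in the eigenbasis
  let F : EuclideanSpace ℝ V := WithLp.toLp 2 f
  let F' : EuclideanSpace ℝ V := WithLp.toLp 2 (M *ᵥ f)
  have hinner : ∀ (x y : V → ℝ), inner ℝ (WithLp.toLp 2 x) (WithLp.toLp 2 y : EuclideanSpace ℝ V) =
      ∑ i, x i * y i := by
    intro x y
    simp [PiLp.inner_apply, mul_comm]
  have hcoef : ∀ i, inner ℝ (e i) F' = hherm.eigenvalues i * inner ℝ (e i) F := by
    intro i
    have h1 : inner ℝ (e i) F' = (e i : V → ℝ) ⬝ᵥ (M *ᵥ f) := hinner _ _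
    have h2 : inner ℝ (e i) F = (e i : V → ℝ) ⬝ᵥ f := hinner _ _
    rw [h1, h2, dotProduct_mulVec, ← mulVec_transpose, hsymm, heig, smul_dotProduct, smul_eq_mul]
  have hbound : ∀ i, (inner ℝ (e i) F') ^ 2 ≤ 4 * Δ * (inner ℝ (e i) F) ^ 2 := by
    intro i
    rw [hcoef, mul_pow]
    have hne : (e i : V → ℝ) ≠ 0 := by
      intro h0
      have h1 := e.norm_eq_one i
      have h2 : e i = 0 := by ext x; exact congrFun h0 x
      rw [h2, norm_zero] at h1
      exact zero_ne_one h1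
    have hev : Module.End.HasEigenvalue (Matrix.toLin' M) (hherm.eigenvalues i) := by
      refine Module.End.hasEigenvalue_of_hasEigenvector (x := (e i : V → ℝ)) ⟨?_, hne⟩
      rw [Module.End.mem_eigenspace_iff, Matrix.toLin'_apply]
      exact heig i
    by_cases h1 : hherm.eigenvalues i = Δ
    · -- the eigenfunction is constant, hence orthogonal to `f`
      have hedge : ∀ x y, E x y → (e i : V → ℝ) x = (e i : V → ℝ) y := by
        intro x y hxy
        have := eq_mul_of_eigen hsymm hreg hpos (f := (e i : V → ℝ)) (s := 1) (by norm_num)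
          (by rw [heig i, h1, one_mul]) (hMpos x y hxy)
        rwa [one_mul] at this
      have hconst : ∀ x y, (e i : V → ℝ) x = (e i : V → ℝ) y := by
        intro x y
        induction h.connected x y with
        | refl => rfl
        | tail _ hbc ih => exact ih.trans (hedge _ _ hbc)
      have h0 : inner ℝ (e i) F = 0 := by
        have h2 : inner ℝ (e i) F = ∑ x, (e i : V → ℝ) x * f x := hinner _ _
        rw [h2]
        rcases isEmpty_or_nonempty V with hV | ⟨⟨x₀⟩⟩
        · simp
        · rw [sum_congr rfl fun x _ => by rw [hconst x x₀], ← mul_sum, hf, mul_zero]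
      rw [h0]; simp
    by_cases h2 : hherm.eigenvalues i = -Δ
    · -- the sign of the eigenfunction would be a bipartition
      exfalso
      have hedge : ∀ x y, E x y → (e i : V → ℝ) x = -(e i : V → ℝ) y := by
        intro x y hxy
        have := eq_mul_of_eigen hsymm hreg hpos (f := (e i : V → ℝ)) (s := -1) (by norm_num)
          (by rw [heig i, h2, neg_one_mul]) (hMpos x y hxy)
        rwa [neg_one_mul] at this
      obtain ⟨x₀, hx₀⟩ : ∃ x, (e i : V → ℝ) x ≠ 0 := by
        by_contra! hc
        exact hne (funext hc)
      have hnz : ∀ y, (e i : V → ℝ) y ≠ 0 := by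
        intro y
        induction h.connected x₀ y with
        | refl => exact hx₀
        | tail _ hbc ih =>
          intro h0
          exact ih (by rw [hedge _ _ hbc, h0, neg_zero])
      refine h.nonbipartite ⟨fun x => decide (0 < (e i : V → ℝ) x), fun x y hxy heq => ?_⟩
      have h3 := hedge x y hxy
      have h4 : (0 < (e i : V → ℝ) x) ↔ (0 < (e i : V → ℝ) y) := by simpa using heq
      rw [h3] at h4
      rcases lt_or_gt_of_ne (hnz y) with h5 | h5
      · have := h4.1 (by linarith)
        linarith
      · have := h4.2 h5
        linarith
    have h3 := h.spectral _ hev h1 h2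
    have h4 : hherm.eigenvalues i ^ 2 ≤ 4 * Δ := by
      rcases Nat.eq_zero_or_pos Δ with h5 | h5
      · have h6 : Real.sqrt ((Δ : ℝ) - 1) = 0 :=
          Real.sqrt_eq_zero_of_nonpos (by rw [h5]; norm_num)
        rw [h6, mul_zero] at h3
        have h7 : hherm.eigenvalues i = 0 := abs_eq_zero.1 (le_antisymm h3 (abs_nonneg _))
        rw [h7]; simp
      · have h6 : (0 : ℝ) ≤ (Δ : ℝ) - 1 := by
          have : (1 : ℝ) ≤ Δ := by exact_mod_cast h5
          linarith
        calc hherm.eigenvalues i ^ 2 = |hherm.eigenvalues i| ^ 2 := (sq_abs _).symm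
          _ ≤ (2 * Real.sqrt ((Δ : ℝ) - 1)) ^ 2 := by gcongr
          _ = 4 * ((Δ : ℝ) - 1) := by rw [mul_pow, Real.sq_sqrt h6]; norm_num
          _ ≤ 4 * Δ := by linarith
    exact mul_le_mul_of_nonneg_right h4 (sq_nonneg _)
  have hparseval : ∀ x : V → ℝ, sqNorm x = ∑ i, (inner ℝ (e i) (WithLp.toLp 2 x)) ^ 2 := by
    intro x
    have h1 := e.sum_sq_norm_inner_right (WithLp.toLp 2 x)
    have h2 : ‖(WithLp.toLp 2 x : EuclideanSpace ℝ V)‖ ^ 2 = sqNorm x := by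
      rw [EuclideanSpace.norm_sq_eq]
      simp [sqNorm]
    rw [← h2, ← h1]
    exact sum_congr rfl fun i _ => by rw [Real.norm_eq_abs, sq_abs]
  rw [hparseval, hparseval, mul_sum]
  exact sum_le_sum fun i _ => hbound i

/-- The counting form of the expander mixing lemma: an operator that multiplies constants by `k`
and contracts the functions of mean zero by `√L` sends the indicator of a small set `Y` above `m`
on few points only. -/
lemma card_mul_sq_le {T : (V → ℝ) →ₗ[ℝ] (V → ℝ)} {k L m : ℝ}
    (hone : T (fun _ => 1) = fun _ => k)
    (hT : ∀ f, ∑ x, f x = 0 → sqNorm (T f) ≤ L * sqNorm f) (hL : 0 ≤ L) {X Y : Finset V}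
    (hm : 0 ≤ m) (hX : ∀ x ∈ X, m ≤ T (fun y => if y ∈ Y then 1 else 0) x)
    (hY : k * #Y ≤ m / 2 * Fintype.card V) :
    #X * m ^ 2 ≤ 4 * L * #Y := by
  rcases isEmpty_or_nonempty V with hV | hV
  · have : X = ∅ := eq_empty_of_isEmpty X
    rw [this]; simp; positivity
  have hn : (0 : ℝ) < Fintype.card V := by exact_mod_cast Fintype.card_pos
  set n : ℝ := ((Fintype.card V : ℕ) : ℝ) with hndef
  let g : V → ℝ := (fun y => if y ∈ Y then 1 else 0) - (#Y / n) • fun _ => (1 : ℝ)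
  have hsum : ∑ x : V, (if x ∈ Y then (1 : ℝ) else 0) = #Y := by simp
  have hg0 : ∑ x, g x = 0 := by
    simp only [g, Pi.sub_apply, Pi.smul_apply, smul_eq_mul, mul_one, sum_sub_distrib, hsum,
      sum_const, card_univ, nsmul_eq_mul]
    rw [← hndef]
    field_simp
    ring
  have hgn : sqNorm g ≤ #Y := by
    have h1 : ∀ x, g x ^ 2 = (1 - 2 * (#Y / n)) * (if x ∈ Y then (1 : ℝ) else 0) +
        (#Y / n) ^ 2 := by
      intro x
      simp only [g, Pi.sub_apply, Pi.smul_apply, smul_eq_mul, mul_one]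
      split_ifs <;> ring
    simp only [sqNorm, h1, sum_add_distrib, ← mul_sum, hsum, sum_const, card_univ, nsmul_eq_mul]
    rw [← hndef]
    have : n * ((#Y : ℝ) / n) ^ 2 = #Y / n * #Y := by field_simp
    rw [this]
    have : 0 ≤ (#Y : ℝ) / n * #Y := by positivity
    nlinarith
  have hTg : ∀ x ∈ X, m / 2 ≤ T g x := by
    intro x hx
    have h1 : T g x = T (fun y => if y ∈ Y then 1 else 0) x - #Y / n * k := by
      simp only [g, map_sub, map_smul, hone]
      simp
    have h2 : #Y / n * k ≤ m / 2 := by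
      rw [div_mul_eq_mul_div, div_le_iff₀ hn, mul_comm]
      exact hY
    linarith [hX x hx]
  have h1 : #X * (m / 2) ^ 2 ≤ sqNorm (T g) := by
    calc #X * (m / 2) ^ 2 = ∑ x ∈ X, (m / 2) ^ 2 := by rw [sum_const, nsmul_eq_mul]
      _ ≤ ∑ x ∈ X, T g x ^ 2 := sum_le_sum fun x hx =>
          pow_le_pow_left₀ (by positivity) (hTg x hx) 2
      _ ≤ ∑ x, T g x ^ 2 := sum_le_univ_sum_of_nonneg fun x => sq_nonneg _
  have h2 : sqNorm (T g) ≤ L * #Y := (hT g hg0).trans (mul_le_mul_of_nonneg_left hgn hL)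
  nlinarith

end Spectral

/-! ### The quadripartite complex and its local views -/

section Geometry

variable {G : Type*} [Group G] [Fintype G] [DecidableEq G] {A B : Finset G}

/-- The other endpoint of the `A`-edge with label `a` at the vertex `v`. -/
def flipA (a : A) (v : Vertex G) : Vertex G :=
  (if v.2.2 = 0 then (a : G) * v.1 else (a : G)⁻¹ * v.1, v.2.1, v.2.2 + 1)

/-- The other endpoint of the `B`-edge with label `b` at the vertex `v`. -/
def flipB (b : B) (v : Vertex G) : Vertex G :=
  (if v.2.1 = 0 then v.1 * (b : G) else v.1 * (b : G)⁻¹, v.2.1 + 1, v.2.2)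

lemma flipA_flipA (a : A) (v : Vertex G) : flipA a (flipA a v) = v := by
  obtain ⟨h, i, j⟩ := v
  fin_cases j <;> simp [flipA]

lemma flipB_flipB (b : B) (v : Vertex G) : flipB b (flipB b v) = v := by
  obtain ⟨h, i, j⟩ := v
  fin_cases i <;> simp [flipB]

lemma flipA_flipB (a : A) (b : B) (v : Vertex G) :
    flipA a (flipB b v) = flipB b (flipA a v) := by
  obtain ⟨h, i, j⟩ := v
  fin_cases i <;> fin_cases j <;> simp [flipA, flipB, mul_assoc]

lemma label_flipA (a : A) (b : B) (v : Vertex G) : label (flipA a v) a b = label v a b := by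
  obtain ⟨h, i, j⟩ := v
  fin_cases j <;> simp [flipA, label]

lemma label_flipB (a : A) (b : B) (v : Vertex G) : label (flipB b v) a b = label v a b := by
  obtain ⟨h, i, j⟩ := v
  fin_cases i <;> simp [flipB, label, mul_assoc]

lemma corner_label (v : Vertex G) (a : A) (b : B) : corner v.2.1 v.2.2 (label v a b) = v.1 := by
  obtain ⟨h, i, j⟩ := v
  fin_cases i <;> fin_cases j <;> simp [corner, label, mul_assoc]

lemma label_of_corner {v : Vertex G} {q : Square A B} (h : corner v.2.1 v.2.2 q = v.1) :
    label v q.2.1 q.2.2 = q := by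
  obtain ⟨g, a, b⟩ := q
  obtain ⟨h', i, j⟩ := v
  dsimp only at h
  subst h
  fin_cases i <;> fin_cases j <;> simp [corner, label, mul_assoc]

lemma flipA_mem_V0 {a : A} {v : Vertex G} : flipA a v ∈ V0 G ↔ v ∈ V1 G := by
  obtain ⟨h, i, j⟩ := v
  simp only [V0, V1, mem_filter, mem_univ, true_and, flipA]
  fin_cases i <;> fin_cases j <;> simp

lemma flipB_mem_V0 {b : B} {v : Vertex G} : flipB b v ∈ V0 G ↔ v ∈ V1 G := by
  obtain ⟨h, i, j⟩ := v
  simp only [V0, V1, mem_filter, mem_univ, true_and, flipB]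
  fin_cases i <;> fin_cases j <;> simp

lemma flipA_mem_V1 {a : A} {v : Vertex G} : flipA a v ∈ V1 G ↔ v ∈ V0 G := by
  rw [← flipA_mem_V0 (a := a), flipA_flipA]

lemma flipB_mem_V1 {b : B} {v : Vertex G} : flipB b v ∈ V1 G ↔ v ∈ V0 G := by
  rw [← flipB_mem_V0 (b := b), flipB_flipB]

lemma localView_apply (v : Vertex G) (x : Square A B → ZMod 2) (a : A) (b : B) :
    localView v x a b = x (label v a b) := rfl

lemma localView_add (v : Vertex G) (x y : Square A B → ZMod 2) :
    localView v (x + y) = localView v x + localView v y := rfl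

lemma localView_flipA (v : Vertex G) (x : Square A B → ZMod 2) (a : A) (b : B) :
    localView (flipA a v) x a b = localView v x a b := by
  rw [localView_apply, label_flipA, localView_apply]

lemma localView_flipB (v : Vertex G) (x : Square A B → ZMod 2) (a : A) (b : B) :
    localView (flipB b v) x a b = localView v x a b := by
  rw [localView_apply, label_flipB, localView_apply]

lemma localView_sum {κ : Type*} (s : Finset κ) (v : Vertex G) (x : κ → Square A B → ZMod 2) :
    localView v (∑ k ∈ s, x k) = ∑ k ∈ s, localView v (x k) := by
  ext a b
  simp only [localView_apply, Finset.sum_apply, Matrix.sum_apply]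

/-- On the vertices of the same part `V_ij` as `v`, a vector supported on `Q(v)` is seen only at
`v` itself. -/
lemma localView_pad_of_eq {v w : Vertex G} (h : w.2 = v.2) (m : Matrix A B (ZMod 2)) :
    localView w (pad v m) = if w = v then m else 0 := by
  ext a b
  have h1 : corner v.2.1 v.2.2 (label w a b) = w.1 := by rw [← h]; exact corner_label w a b
  have h2 : w = v ↔ w.1 = v.1 := ⟨fun e => by rw [e], fun e => Prod.ext e h⟩
  rw [localView_apply, pad, h1]
  simp only [h2]
  split_ifs <;> rfl

lemma fin_two_add_one_of_ne {i j : Fin 2} (h : i ≠ j) : i + 1 = j := by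
  revert i j; decide

lemma localView_pad_mem_columnCode {CA : Submodule (ZMod 2) (A → ZMod 2)} {v w : Vertex G}
    (h : w.2.2 = v.2.2) {m : Matrix A B (ZMod 2)} (hm : m ∈ columnCode CA) :
    localView w (pad v m) ∈ columnCode CA := by
  have key : ∀ w' : Vertex G, w'.2 = v.2 → localView w' (pad v m) ∈ columnCode CA := by
    intro w' h'
    rw [localView_pad_of_eq h']
    split_ifs
    · exact hm
    · exact Submodule.zero_mem _
  by_cases h1 : w.2.1 = v.2.1
  · exact key w (Prod.ext h1 h)
  · intro b
    have := key (flipB b w) (Prod.ext (fin_two_add_one_of_ne h1) h) b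
    simpa only [localView_flipB] using this

lemma localView_pad_mem_rowCode {CB : Submodule (ZMod 2) (B → ZMod 2)} {v w : Vertex G}
    (h : w.2.1 = v.2.1) {m : Matrix A B (ZMod 2)} (hm : m ∈ rowCode CB) :
    localView w (pad v m) ∈ rowCode CB := by
  have key : ∀ w' : Vertex G, w'.2 = v.2 → localView w' (pad v m) ∈ rowCode CB := by
    intro w' h'
    rw [localView_pad_of_eq h']
    split_ifs
    · exact hm
    · exact Submodule.zero_mem _
  by_cases h1 : w.2.2 = v.2.2
  · exact key w (Prod.ext h h1)
  · intro a
    have := key (flipA a w) (Prod.ext h (fin_two_add_one_of_ne h1)) a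
    simpa only [localView_flipA] using this

lemma hammingNorm_eq_weight_add (v : Vertex G) (x : Square A B → ZMod 2) :
    hammingNorm x = weight (localView v x) +
      #{q : Square A B | corner v.2.1 v.2.2 q ≠ v.1 ∧ x q ≠ 0} := by
  have h1 : weight (localView v x) =
      #{q : Square A B | corner v.2.1 v.2.2 q = v.1 ∧ x q ≠ 0} := by
    refine card_bij (fun q _ => label v q.1 q.2) ?_ ?_ ?_
    · intro q hq
      exact mem_filter.2 ⟨mem_univ _, corner_label v q.1 q.2, (mem_filter.1 hq).2⟩
    · intro q _ q' _ h
      exact Prod.ext (congrArg (fun s : Square A B => s.2.1) h)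
        (congrArg (fun s : Square A B => s.2.2) h)
    · intro q hq
      obtain ⟨-, h2, h3⟩ := mem_filter.1 hq
      refine ⟨q.2, mem_filter.2 ⟨by simp, ?_⟩, label_of_corner h2⟩
      rw [localView_apply, label_of_corner h2]
      exact h3
  rw [h1, hammingNorm, ← card_union_of_disjoint]
  · congr 1
    ext q
    simp only [mem_filter, mem_univ, true_and, mem_union]
    tauto
  · rw [disjoint_filter]
    rintro q _ ⟨h2, -⟩ ⟨h3, -⟩
    exact h3 h2

lemma hammingNorm_add_pad (v : Vertex G) (x : Square A B → ZMod 2) (m : Matrix A B (ZMod 2)) :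
    hammingNorm (x + pad v m) + weight (localView v x) =
      hammingNorm x + weight (localView v x + m) := by
  rw [hammingNorm_eq_weight_add v (x + pad v m), hammingNorm_eq_weight_add v x, localView_add,
    localView_pad_of_eq rfl, if_pos rfl]
  have : #{q : Square A B | corner v.2.1 v.2.2 q ≠ v.1 ∧ (x + pad v m) q ≠ 0} =
      #{q : Square A B | corner v.2.1 v.2.2 q ≠ v.1 ∧ x q ≠ 0} := by
    refine congrArg card (filter_congr fun q _ => and_congr_right fun h => ?_)
    rw [Pi.add_apply, pad, if_neg h, add_zero]
  rw [this]
  ring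

lemma Stalled.weight_le {CA : Submodule (ZMod 2) (A → ZMod 2)}
    {CB : Submodule (ZMod 2) (B → ZMod 2)} {z : Square A B → ZMod 2} (h : Stalled CA CB z)
    {v : Vertex G} (hv : v ∈ V0 G) {c r : Matrix A B (ZMod 2)} (hc : c ∈ columnCode CA)
    (hr : r ∈ rowCode CB) :
    weight (localView v z) ≤ weight (localView v z + (c + r)) := by
  have h1 := h v hv c hc r hr
  have h2 := hammingNorm_add_pad v z (c + r)
  omega

end Geometry

/-! ### Decompositions of the mismatch -/

section Decompositions

variable {G : Type*} [Group G] [Fintype G] [DecidableEq G] {A B : Finset G}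

/-- The row part `R_i` of a quadruple on the local view at a vertex of `V_ij`. -/
def Quadruple.rowsAt (Z : Quadruple A B) (v : Vertex G) : Matrix A B (ZMod 2) :=
  localView v (Z.R v.2.1)

/-- The column part `C_j` of a quadruple on the local view at a vertex of `V_ij`. -/
def Quadruple.colsAt (Z : Quadruple A B) (v : Vertex G) : Matrix A B (ZMod 2) :=
  localView v (Z.C v.2.2)

/-- The part of the mismatch on the local view at `v` that is not a codeword of `v`: it consists of
rows seen from the `B`-neighbours of `v` and of columns seen from its `A`-neighbours. -/
def Quadruple.noiseAt (Z : Quadruple A B) (v : Vertex G) : Matrix A B (ZMod 2) :=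
  Matrix.of fun a b => Z.rowsAt (flipB b v) a b + Z.colsAt (flipA a v) a b

lemma Quadruple.rowsAt_flipA (Z : Quadruple A B) (a : A) (v : Vertex G) :
    Z.rowsAt (flipA a v) a = Z.rowsAt v a :=
  funext fun b => localView_flipA v (Z.R v.2.1) a b

lemma Quadruple.colsAt_flipB (Z : Quadruple A B) (a : A) (b : B) (v : Vertex G) :
    Z.colsAt (flipB b v) a b = Z.colsAt v a b :=
  localView_flipB v (Z.C v.2.2) a b

lemma Quadruple.colsAt_transpose_flipB (Z : Quadruple A B) (b : B) (v : Vertex G) :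
    (Z.colsAt (flipB b v))ᵀ b = (Z.colsAt v)ᵀ b :=
  funext fun a => Z.colsAt_flipB a b v

variable {CA : Submodule (ZMod 2) (A → ZMod 2)} {CB : Submodule (ZMod 2) (B → ZMod 2)}
  {Z : Quadruple A B} {z : Square A B → ZMod 2}

lemma sum_fin_two (f : Fin 2 → ZMod 2) (i : Fin 2) : f 0 + f 1 = f i + f (i + 1) := by
  fin_cases i
  · rfl
  · exact add_comm _ _

lemma Quadruple.IsDecomposition.localView_eq (h : Z.IsDecomposition CA CB z) (v : Vertex G) :
    localView v z = Z.noiseAt v + Z.rowsAt v + Z.colsAt v := by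
  ext a b
  have h1 : Z.rowsAt (flipB b v) a b = Z.R (v.2.1 + 1) (label v a b) :=
    localView_flipB v (Z.R (v.2.1 + 1)) a b
  have h2 : Z.colsAt (flipA a v) a b = Z.C (v.2.2 + 1) (label v a b) :=
    localView_flipA v (Z.C (v.2.2 + 1)) a b
  have h3 : Z.rowsAt v a b = Z.R v.2.1 (label v a b) := rfl
  have h4 : Z.colsAt v a b = Z.C v.2.2 (label v a b) := rfl
  have h5 := sum_fin_two (fun i => Z.R i (label v a b)) v.2.1
  have h6 := sum_fin_two (fun i => Z.C i (label v a b)) v.2.2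
  rw [Matrix.add_apply, Matrix.add_apply, noiseAt, Matrix.of_apply, h1, h2, h3, h4,
    localView_apply, h.sum_eq]
  simp only [Pi.add_apply]
  linear_combination h5 + h6

/-- The number of nonzero rows and columns on the local views at the vertices of `S`. For `S = V₁`
this is, by definition, the norm. -/
def Quadruple.normOn (Z : Quadruple A B) (S : Finset (Vertex G)) : ℕ :=
  ∑ v ∈ S, (colNorm (Z.colsAt v) + rowNorm (Z.rowsAt v))

lemma Quadruple.sum_rowNorm (Z : Quadruple A B) :
    ∑ v ∈ V1 G, rowNorm (Z.rowsAt v) = ∑ v ∈ V0 G, rowNorm (Z.rowsAt v) := by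
  simp only [rowNorm, card_filter]
  rw [Finset.sum_comm, Finset.sum_comm (s := V0 G)]
  refine sum_congr rfl fun a _ => ?_
  refine sum_nbij' (flipA a) (flipA a) (fun v hv => flipA_mem_V0.2 hv)
    (fun v hv => flipA_mem_V1.2 hv) (fun v _ => flipA_flipA a v) (fun v _ => flipA_flipA a v)
    fun v _ => ?_
  have : (fun b => Z.rowsAt (flipA a v) a b) = fun b => Z.rowsAt v a b := Z.rowsAt_flipA a v
  simp only [this]

lemma Quadruple.sum_colNorm (Z : Quadruple A B) :
    ∑ v ∈ V1 G, colNorm (Z.colsAt v) = ∑ v ∈ V0 G, colNorm (Z.colsAt v) := by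
  simp only [colNorm, card_filter]
  rw [Finset.sum_comm, Finset.sum_comm (s := V0 G)]
  refine sum_congr rfl fun b _ => ?_
  refine sum_nbij' (flipB b) (flipB b) (fun v hv => flipB_mem_V0.2 hv)
    (fun v hv => flipB_mem_V1.2 hv) (fun v _ => flipB_flipB b v) (fun v _ => flipB_flipB b v)
    fun v _ => ?_
  simp only [Z.colsAt_flipB]

/-- Each row or column is an edge with one endpoint in `V₀` and one in `V₁`, so the norm can be
computed on either side. -/
lemma Quadruple.norm_eq_normOn_V0 (Z : Quadruple A B) : Z.norm = Z.normOn (V0 G) := by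
  rw [normOn, sum_add_distrib, ← sum_rowNorm, ← sum_colNorm, ← sum_add_distrib]
  rfl

/-- Adding the local vector `t` on `Q(v)` both to the row part and to the column part of `v`. -/
def Quadruple.addAt (Z : Quadruple A B) (v : Vertex G) (t : Matrix A B (ZMod 2)) :
    Quadruple A B where
  C := fun j => Z.C j + if j = v.2.2 then pad v t else 0
  R := fun i => Z.R i + if i = v.2.1 then pad v t else 0

lemma Quadruple.IsDecomposition.addAt (h : Z.IsDecomposition CA CB z) (v : Vertex G)
    {t : Matrix A B (ZMod 2)} (ht : t ∈ tensorCode CA CB) :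
    (Z.addAt v t).IsDecomposition CA CB z where
  col_mem := fun w => by
    refine Submodule.add_mem _ (h.col_mem w) ?_
    split_ifs with h1
    · exact localView_pad_mem_columnCode h1 ht.1
    · exact Submodule.zero_mem _
  row_mem := fun w => by
    refine Submodule.add_mem _ (h.row_mem w) ?_
    split_ifs with h1
    · exact localView_pad_mem_rowCode h1 ht.2
    · exact Submodule.zero_mem _
  sum_eq := by
    rw [h.sum_eq]
    ext q
    have e : ∀ x : ZMod 2, x + x = 0 := ZModModule.add_self
    have h1 : ∀ k : Fin 2, (if 0 = k then pad v t else 0) q + (if 1 = k then pad v t else 0) q =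
        pad v t q := by
      intro k
      fin_cases k <;> simp
    simp only [Quadruple.addAt, Pi.add_apply]
    linear_combination -h1 v.2.1 - h1 v.2.2 - e (pad v t q)

lemma snd_eq_of_mem_V1 {v w : Vertex G} (hv : v ∈ V1 G) (hw : w ∈ V1 G)
    (h : w.2.1 = v.2.1 ∨ w.2.2 = v.2.2) : w.2 = v.2 := by
  obtain ⟨g, i, j⟩ := v
  obtain ⟨g', i', j'⟩ := w
  simp only [V1, mem_filter, mem_univ, true_and] at hv hw h ⊢
  revert hv hw h
  revert i j i' j'
  decide

lemma snd_eq_of_mem_V0 {v w : Vertex G} (hv : v ∈ V0 G) (hw : w ∈ V0 G)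
    (h : w.2.1 = v.2.1 ∨ w.2.2 = v.2.2) : w.2 = v.2 := by
  obtain ⟨g, i, j⟩ := v
  obtain ⟨g', i', j'⟩ := w
  simp only [V0, mem_filter, mem_univ, true_and] at hv hw h ⊢
  revert hv hw h
  revert i j i' j'
  decide

lemma Quadruple.rowsAt_addAt (Z : Quadruple A B) {v w : Vertex G} {t : Matrix A B (ZMod 2)}
    (h : w.2.1 = v.2.1 ∨ w.2.2 = v.2.2 → w.2 = v.2) :
    (Z.addAt v t).rowsAt w = Z.rowsAt w + if w = v then t else 0 := by
  change Z.rowsAt w + localView w (if w.2.1 = v.2.1 then pad v t else 0) = _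
  congr 1
  by_cases h1 : w.2.1 = v.2.1
  · rw [if_pos h1, localView_pad_of_eq (h (Or.inl h1))]
  · rw [if_neg h1, if_neg fun e => h1 (by rw [e])]
    rfl

lemma Quadruple.colsAt_addAt (Z : Quadruple A B) {v w : Vertex G} {t : Matrix A B (ZMod 2)}
    (h : w.2.1 = v.2.1 ∨ w.2.2 = v.2.2 → w.2 = v.2) :
    (Z.addAt v t).colsAt w = Z.colsAt w + if w = v then t else 0 := by
  change Z.colsAt w + localView w (if w.2.2 = v.2.2 then pad v t else 0) = _
  congr 1
  by_cases h1 : w.2.2 = v.2.2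
  · rw [if_pos h1, localView_pad_of_eq (h (Or.inr h1))]
  · rw [if_neg h1, if_neg fun e => h1 (by rw [e])]
    rfl

lemma Quadruple.le_of_normOn_addAt_le {S : Finset (Vertex G)} {v : Vertex G} (hv : v ∈ S)
    (hS : ∀ w ∈ S, w.2.1 = v.2.1 ∨ w.2.2 = v.2.2 → w.2 = v.2) {t : Matrix A B (ZMod 2)}
    (h : Z.normOn S ≤ (Z.addAt v t).normOn S) :
    colNorm (Z.colsAt v) + rowNorm (Z.rowsAt v) ≤
      colNorm (Z.colsAt v + t) + rowNorm (Z.rowsAt v + t) := by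
  rw [normOn, normOn, ← add_sum_erase _ _ hv, ← add_sum_erase S _ hv] at h
  have h1 : ∀ w ∈ S.erase v, colNorm ((Z.addAt v t).colsAt w) + rowNorm ((Z.addAt v t).rowsAt w) =
      colNorm (Z.colsAt w) + rowNorm (Z.rowsAt w) := by
    intro w hw
    rw [Z.rowsAt_addAt (hS w (mem_of_mem_erase hw)), Z.colsAt_addAt (hS w (mem_of_mem_erase hw)),
      if_neg (ne_of_mem_erase hw), add_zero, add_zero]
  rw [sum_congr rfl h1, Z.rowsAt_addAt (hS v hv), Z.colsAt_addAt (hS v hv), if_pos rfl] at h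
  omega

/-- A decomposition of minimum norm is locally minimal at every vertex, with respect to the
exchange of a tensor codeword between rows and columns. -/
lemma Quadruple.IsMinimal.le_add (h : Z.IsMinimal CA CB z) (v : Vertex G)
    {t : Matrix A B (ZMod 2)} (ht : t ∈ tensorCode CA CB) :
    colNorm (Z.colsAt v) + rowNorm (Z.rowsAt v) ≤
      colNorm (Z.colsAt v + t) + rowNorm (Z.rowsAt v + t) := by
  have h1 := h.2 _ (h.1.addAt v ht)
  by_cases hv : v ∈ V0 G
  · rw [norm_eq_normOn_V0, norm_eq_normOn_V0] at h1
    exact le_of_normOn_addAt_le hv (fun w hw => snd_eq_of_mem_V0 hv hw) h1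
  · have hv' : v ∈ V1 G := by simpa [V0, V1] using hv
    exact le_of_normOn_addAt_le hv' (fun w hw => snd_eq_of_mem_V1 hv' hw) h1

lemma Quadruple.mem_active {v : Vertex G} :
    v ∈ Z.active ↔ v ∈ V0 G ∧ Z.rowsAt v + Z.colsAt v ≠ 0 :=
  mem_filter

lemma rowNorm_zero : rowNorm (0 : Matrix A B (ZMod 2)) = 0 := by
  simp [rowNorm, funext_iff]

lemma colNorm_zero : colNorm (0 : Matrix A B (ZMod 2)) = 0 := by
  simp [colNorm, funext_iff]

/-- At an inactive vertex the row part equals the column part, a tensor codeword, which minimality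
forces to vanish. -/
lemma Quadruple.IsMinimal.eq_zero_of_not_active (h : Z.IsMinimal CA CB z) {v : Vertex G}
    (hv : v ∈ V0 G) (hna : v ∉ Z.active) : Z.rowsAt v = 0 ∧ Z.colsAt v = 0 := by
  have h0 : Z.rowsAt v + Z.colsAt v = 0 := by
    by_contra h0
    exact hna (mem_active.2 ⟨hv, h0⟩)
  have heq : Z.rowsAt v = Z.colsAt v := by
    rw [← sub_eq_zero, ZModModule.sub_eq_add]
    exact h0
  have ht : Z.colsAt v ∈ tensorCode CA CB := ⟨h.1.col_mem v, heq ▸ h.1.row_mem v⟩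
  have h1 := h.le_add v ht
  rw [heq, ZModModule.add_self, rowNorm_zero, colNorm_zero] at h1
  have h2 : rowNorm (Z.colsAt v) = 0 := by omega
  have h3 : Z.colsAt v = 0 := by
    rw [rowNorm, card_eq_zero, filter_eq_empty_iff] at h2
    ext a b
    have := h2 (mem_univ a)
    rw [not_not] at this
    exact congrFun this b
  exact ⟨heq.trans h3, h3⟩

lemma Quadruple.rowsAt_update (Z : Quadruple A B)
    (u : Vertex G → Matrix A B (ZMod 2) × Matrix A B (ZMod 2)) {v : Vertex G} (hv : v ∈ V1 G) :
    (Z.update u).rowsAt v = Z.rowsAt v + (u v).1 := by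
  change Z.rowsAt v + localView v (∑ w ∈ (V1 G).filter (fun w => w.2.1 = v.2.1), pad w (u w).1) = _
  congr 1
  rw [localView_sum, sum_eq_single v]
  · rw [localView_pad_of_eq rfl, if_pos rfl]
  · intro w hw hne
    rw [localView_pad_of_eq (snd_eq_of_mem_V1 hv (mem_filter.1 hw).1
      (Or.inl (mem_filter.1 hw).2)).symm, if_neg hne.symm]
  · intro h
    exact (h (mem_filter.2 ⟨hv, rfl⟩)).elim

lemma Quadruple.colsAt_update (Z : Quadruple A B)
    (u : Vertex G → Matrix A B (ZMod 2) × Matrix A B (ZMod 2)) {v : Vertex G} (hv : v ∈ V1 G) :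
    (Z.update u).colsAt v = Z.colsAt v + (u v).2 := by
  change Z.colsAt v + localView v (∑ w ∈ (V1 G).filter (fun w => w.2.2 = v.2.2), pad w (u w).2) = _
  congr 1
  rw [localView_sum, sum_eq_single v]
  · rw [localView_pad_of_eq rfl, if_pos rfl]
  · intro w hw hne
    rw [localView_pad_of_eq (snd_eq_of_mem_V1 hv (mem_filter.1 hw).1
      (Or.inr (mem_filter.1 hw).2)).symm, if_neg hne.symm]
  · intro h
    exact (h (mem_filter.2 ⟨hv, rfl⟩)).elim

end Decompositions

/-! ### Expansion in the quadripartite complex -/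

section Counting

variable {G : Type*} [Group G] [Fintype G] [DecidableEq G] {A B : Finset G} {Δ : ℕ}

/-- The adjacency operator of the left Cayley graph. -/
def leftOp (A : Finset G) : (G → ℝ) →ₗ[ℝ] (G → ℝ) where
  toFun f x := ∑ a : A, f (a * x)
  map_add' f g := by ext x; simp [sum_add_distrib]
  map_smul' s f := by ext x; simp [mul_sum]

/-- The adjacency operator of the right Cayley graph. -/
def rightOp (B : Finset G) : (G → ℝ) →ₗ[ℝ] (G → ℝ) where
  toFun f x := ∑ b : B, f (x * b)
  map_add' f g := by ext x; simp [sum_add_distrib]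
  map_smul' s f := by ext x; simp [mul_sum]

lemma leftOp_apply (f : G → ℝ) (x : G) : leftOp A f x = ∑ a : A, f (a * x) := rfl

lemma rightOp_apply (f : G → ℝ) (x : G) : rightOp B f x = ∑ b : B, f (x * b) := rfl

lemma leftOp_eq_mulVec (f : G → ℝ) :
    leftOp A f = (Matrix.of fun x y => if leftCay A x y then (1 : ℝ) else 0) *ᵥ f := by
  ext x
  rw [leftOp_apply, mulVec, dotProduct, sum_coe_sort A fun a => f (a * x)]
  simp only [Matrix.of_apply, ite_mul, one_mul, zero_mul]
  rw [← sum_filter]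
  refine sum_nbij' (fun a => a * x) (fun y => y * x⁻¹) ?_ ?_ ?_ ?_ ?_ <;> simp [leftCay]

lemma rightOp_eq_mulVec (f : G → ℝ) :
    rightOp B f = (Matrix.of fun x y => if rightCay B x y then (1 : ℝ) else 0) *ᵥ f := by
  ext x
  rw [rightOp_apply, mulVec, dotProduct, sum_coe_sort B fun b => f (x * b)]
  simp only [Matrix.of_apply, ite_mul, one_mul, zero_mul]
  rw [← sum_filter]
  refine sum_nbij' (fun b => x * b) (fun y => x⁻¹ * y) ?_ ?_ ?_ ?_ ?_ <;> simp [rightCay]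

lemma sqNorm_leftOp_le (hA : #A = Δ) (hinv : ∀ a ∈ A, a⁻¹ ∈ A)
    (h : NonbipartiteRamanujan (leftCay A) Δ) {f : G → ℝ} (hf : ∑ x, f x = 0) :
    sqNorm (leftOp A f) ≤ 4 * Δ * sqNorm f := by
  rw [leftOp_eq_mulVec]
  refine h.sqNorm_mulVec_le (fun x y hxy => ?_) (fun x => ?_) hf
  · have := hinv _ hxy
    rwa [_root_.mul_inv_rev, inv_inv] at this
  · rw [← hA]
    refine card_nbij' (fun y => y * x⁻¹) (fun a => a * x) ?_ ?_ ?_ ?_ <;> simp [leftCay, Set.MapsTo, Set.LeftInvOn, Set.RightInvOn]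

lemma sqNorm_rightOp_le (hB : #B = Δ) (hinv : ∀ b ∈ B, b⁻¹ ∈ B)
    (h : NonbipartiteRamanujan (rightCay B) Δ) {f : G → ℝ} (hf : ∑ x, f x = 0) :
    sqNorm (rightOp B f) ≤ 4 * Δ * sqNorm f := by
  rw [rightOp_eq_mulVec]
  refine h.sqNorm_mulVec_le (fun x y hxy => ?_) (fun x => ?_) hf
  · have := hinv _ hxy
    rwa [_root_.mul_inv_rev, inv_inv] at this
  · rw [← hB]
    refine card_nbij' (fun y => x⁻¹ * y) (fun b => x * b) ?_ ?_ ?_ ?_ <;> simp [rightCay, Set.MapsTo, Set.LeftInvOn, Set.RightInvOn]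

lemma leftOp_one (hA : #A = Δ) : leftOp A (fun _ => 1) = fun _ => (Δ : ℝ) := by
  ext x; simp [leftOp_apply, hA]

lemma rightOp_one (hB : #B = Δ) : rightOp B (fun _ => 1) = fun _ => (Δ : ℝ) := by
  ext x; simp [rightOp_apply, hB]

lemma sum_rightOp {f : G → ℝ} (hf : ∑ x, f x = 0) : ∑ x, rightOp B f x = 0 := by
  simp only [rightOp_apply]
  rw [Finset.sum_comm]
  refine sum_eq_zero fun b _ => ?_
  rw [← hf]
  exact Equiv.sum_comp (Equiv.mulRight (b : G)) f

lemma card_eq_sum_card_parts (X : Finset (Vertex G)) :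
    #X = ∑ c : Fin 2 × Fin 2, #{h : G | (h, c) ∈ X} := by
  simp only [card_filter]
  rw [← Fintype.sum_prod_type_right (fun v : G × Fin 2 × Fin 2 => if v ∈ X then 1 else 0),
    ← card_filter, filter_mem_eq_inter, univ_inter]

/-- Expansion in the quadripartite complex, from the expansion of an operator on `G` that connects
the part `c` to the part `σ c`. -/
lemma card_vertices_mul_sq_le {T : (G → ℝ) →ₗ[ℝ] (G → ℝ)} {k L m : ℝ}
    (hone : T (fun _ => 1) = fun _ => k)
    (hT : ∀ f, ∑ x, f x = 0 → sqNorm (T f) ≤ L * sqNorm f) (hL : 0 ≤ L) (hk : 0 ≤ k)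
    {X Y : Finset (Vertex G)} (hm : 0 ≤ m) (σ : Equiv.Perm (Fin 2 × Fin 2))
    (hX : ∀ v ∈ X, m ≤ T (fun y => if (y, σ v.2) ∈ Y then 1 else 0) v.1)
    (hY : k * #Y ≤ m / 2 * Fintype.card G) :
    #X * m ^ 2 ≤ 4 * L * #Y := by
  have hpart : ∀ c : Fin 2 × Fin 2, #{h : G | (h, c) ∈ X} * m ^ 2 ≤
      4 * L * #{h : G | (h, σ c) ∈ Y} := by
    intro c
    refine card_mul_sq_le hone hT hL hm (fun x hx => ?_) (le_trans ?_ hY)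
    · have := hX (x, c) (mem_filter.1 hx).2
      simpa using this
    · refine mul_le_mul_of_nonneg_left ?_ hk
      rw [card_eq_sum_card_parts Y]
      exact_mod_cast single_le_sum (f := fun c => #{h : G | (h, c) ∈ Y})
        (fun _ _ => Nat.zero_le _) (mem_univ (σ c))
  rw [card_eq_sum_card_parts X, card_eq_sum_card_parts Y,
    ← Equiv.sum_comp σ fun c => #{h : G | (h, c) ∈ Y}]
  push_cast
  rw [sum_mul, mul_sum]
  exact sum_le_sum fun c _ => hpart c

lemma sum_inv_eq (hinv : ∀ a ∈ A, a⁻¹ ∈ A) (f : G → ℝ) :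
    ∑ a : A, f (a : G)⁻¹ = ∑ a : A, f a := by
  rw [sum_coe_sort A fun a => f a⁻¹, sum_coe_sort A f]
  refine sum_nbij' (fun a => a⁻¹) (fun a => a⁻¹) ?_ ?_ ?_ ?_ ?_ <;> simp_all

/-- Both orientations of the `A`-edges give the same neighbours in `G`, because `A = A⁻¹`. -/
lemma sum_flipA (hinv : ∀ a ∈ A, a⁻¹ ∈ A) (v : Vertex G) (f : Vertex G → ℝ) :
    ∑ a : A, f (flipA a v) = leftOp A (fun y => f (y, v.2.1, v.2.2 + 1)) v.1 := by
  rw [leftOp_apply]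
  by_cases h : v.2.2 = 0
  · simp only [flipA, if_pos h]
  · simp only [flipA, if_neg h]
    exact sum_inv_eq hinv fun a => f (a * v.1, v.2.1, v.2.2 + 1)

lemma sum_flipB (hinv : ∀ b ∈ B, b⁻¹ ∈ B) (v : Vertex G) (f : Vertex G → ℝ) :
    ∑ b : B, f (flipB b v) = rightOp B (fun y => f (y, v.2.1 + 1, v.2.2)) v.1 := by
  rw [rightOp_apply]
  by_cases h : v.2.1 = 0
  · simp only [flipB, if_pos h]
  · simp only [flipB, if_neg h]
    exact sum_inv_eq hinv fun b => f (v.1 * b, v.2.1 + 1, v.2.2)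

/-- Few vertices have `m` or more `A`-neighbours in a small set. -/
lemma card_mul_sq_le_of_flipA (hA : #A = Δ) (hinv : ∀ a ∈ A, a⁻¹ ∈ A)
    (h : NonbipartiteRamanujan (leftCay A) Δ) {X Y : Finset (Vertex G)} {m : ℝ} (hm : 0 ≤ m)
    (hX : ∀ v ∈ X, m ≤ #{a : A | flipA a v ∈ Y}) (hY : Δ * #Y ≤ m / 2 * Fintype.card G) :
    #X * m ^ 2 ≤ 16 * Δ * #Y := by
  have := card_vertices_mul_sq_le (leftOp_one hA) (fun f hf => sqNorm_leftOp_le hA hinv h hf)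
    (by positivity) (by positivity) hm ((Equiv.refl _).prodCongr (Equiv.addRight 1))
    (X := X) (Y := Y) (fun v hv => ?_) hY
  · linarith
  · refine (hX v hv).trans (le_of_eq ?_)
    rw [card_filter]
    push_cast
    exact sum_flipA hinv v fun w => if w ∈ Y then 1 else 0

/-- Few vertices have `m` or more `B`-neighbours in a small set. -/
lemma card_mul_sq_le_of_flipB (hB : #B = Δ) (hinv : ∀ b ∈ B, b⁻¹ ∈ B)
    (h : NonbipartiteRamanujan (rightCay B) Δ) {X Y : Finset (Vertex G)} {m : ℝ} (hm : 0 ≤ m)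
    (hX : ∀ v ∈ X, m ≤ #{b : B | flipB b v ∈ Y}) (hY : Δ * #Y ≤ m / 2 * Fintype.card G) :
    #X * m ^ 2 ≤ 16 * Δ * #Y := by
  have := card_vertices_mul_sq_le (rightOp_one hB) (fun f hf => sqNorm_rightOp_le hB hinv h hf)
    (by positivity) (by positivity) hm ((Equiv.addRight 1).prodCongr (Equiv.refl _))
    (X := X) (Y := Y) (fun v hv => ?_) hY
  · linarith
  · refine (hX v hv).trans (le_of_eq ?_)
    rw [card_filter]
    push_cast
    exact sum_flipB hinv v fun w => if w ∈ Y then 1 else 0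

/-- Few vertices are opposite, in `m` or more squares, to vertices of a small set. -/
lemma card_mul_sq_le_of_opposite (hA : #A = Δ) (hB : #B = Δ) (hinvA : ∀ a ∈ A, a⁻¹ ∈ A)
    (hinvB : ∀ b ∈ B, b⁻¹ ∈ B) (hL : NonbipartiteRamanujan (leftCay A) Δ)
    (hR : NonbipartiteRamanujan (rightCay B) Δ) {X Y : Finset (Vertex G)} {m : ℝ} (hm : 0 ≤ m)
    (hX : ∀ v ∈ X, m ≤ #{q : A × B | flipB q.2 (flipA q.1 v) ∈ Y})
    (hY : Δ ^ 2 * #Y ≤ m / 2 * Fintype.card G) :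
    #X * m ^ 2 ≤ 64 * Δ ^ 2 * #Y := by
  have hone : (leftOp A ∘ₗ rightOp B) (fun _ => 1) = fun _ => (Δ : ℝ) ^ 2 := by
    rw [LinearMap.comp_apply, rightOp_one hB]
    have : (fun _ : G => (Δ : ℝ)) = (Δ : ℝ) • fun _ => (1 : ℝ) := by ext; simp
    rw [this, map_smul, leftOp_one hA]
    ext; simp [sq]
  have hop : ∀ f : G → ℝ, ∑ x, f x = 0 →
      sqNorm ((leftOp A ∘ₗ rightOp B) f) ≤ 16 * Δ ^ 2 * sqNorm f := by
    intro f hf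
    have h1 := sqNorm_leftOp_le hA hinvA hL (sum_rightOp (B := B) hf)
    have h2 := mul_le_mul_of_nonneg_left (sqNorm_rightOp_le hB hinvB hR hf)
      (by positivity : (0 : ℝ) ≤ 4 * Δ)
    rw [LinearMap.comp_apply]
    linarith
  have := card_vertices_mul_sq_le hone hop (by positivity) (by positivity) hm
    ((Equiv.addRight 1).prodCongr (Equiv.addRight 1)) (X := X) (Y := Y) (fun v hv => ?_) hY
  · linarith
  · refine (hX v hv).trans (le_of_eq ?_)
    rw [card_filter, Fintype.sum_prod_type]
    push_cast
    have h1 : ∀ a : A, ∑ b : B, (if flipB b (flipA a v) ∈ Y then (1 : ℝ) else 0) =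
        rightOp B (fun y => if (y, v.2.1 + 1, v.2.2 + 1) ∈ Y then 1 else 0) (flipA a v).1 :=
      fun a => sum_flipB hinvB (flipA a v) fun w => if w ∈ Y then 1 else 0
    simp only [h1]
    exact sum_flipA hinvA v fun w =>
      rightOp B (fun y => if (y, v.2.1 + 1, v.2.2 + 1) ∈ Y then 1 else 0) w.1

end Counting

/-! ### Atypical vertices and their influence -/

section Noise

variable {α β : Type*} [Fintype α] [Fintype β] [DecidableEq α] [DecidableEq β]

/-- A matrix of small weight on a large rectangle has few heavy rows. -/
lemma card_heavy_rows_le {N : Matrix α β (ZMod 2)} {S : Finset α} {T : Finset β} {q W d : ℝ}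
    (hS : (#Sᶜ : ℝ) ≤ q) (hT : (#Tᶜ : ℝ) ≤ q) (hW : (weightOn S T N : ℝ) ≤ W) (hd : 0 < d)
    (hq : q ≤ d / 8) :
    (#{a | d / 4 < hammingNorm (N a)} : ℝ) ≤ q + W / (d / 8) := by
  set H : Finset α := {a | d / 4 < hammingNorm (N a)} with hH
  have h1 : #H ≤ #(S ∩ H) + #Sᶜ := by
    rw [← card_inter_add_card_sdiff H S, inter_comm]
    exact Nat.add_le_add_left (card_le_card fun a ha => by simp_all) _
  have h2 : ∀ a ∈ S ∩ H, d / 8 ≤ (#(T.filter fun b => N a b ≠ 0) : ℝ) := by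
    intro a ha
    have h3 : d / 4 < hammingNorm (N a) := (mem_filter.1 (mem_inter.1 ha).2).2
    have h4 : hammingNorm (N a) ≤ #(T.filter fun b => N a b ≠ 0) + #Tᶜ := by
      refine le_trans (card_le_card fun b hb => ?_) (card_union_le _ _)
      by_cases h : b ∈ T <;> simp_all
    have h5 : (hammingNorm (N a) : ℝ) ≤ #(T.filter fun b => N a b ≠ 0) + #Tᶜ := by
      exact_mod_cast h4
    linarith
  have h3 : (#(S ∩ H) : ℝ) * (d / 8) ≤ W := by
    refine le_trans ?_ hW
    rw [weightOn_eq_sum_rows, ← nsmul_eq_mul, ← sum_const]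
    push_cast
    exact (sum_le_sum h2).trans (sum_le_sum_of_subset_of_nonneg inter_subset_left
      fun _ _ _ => Nat.cast_nonneg _)
  have h4 : (#(S ∩ H) : ℝ) ≤ W / (d / 8) := by
    rwa [le_div_iff₀ (by linarith)]
  have h5 : (#H : ℝ) ≤ #(S ∩ H) + #Sᶜ := by exact_mod_cast h1
  linarith

end Noise

section Setting

variable {G : Type*} [Group G] [Fintype G] [DecidableEq G] {A B : Finset G}

/-- The vertices with at least `m` neighbours in `Y` of the same kind (`A`-neighbours or
`B`-neighbours). -/
noncomputable def crowded (A B : Finset G) (m : ℝ) (Y : Finset (Vertex G)) : Finset (Vertex G) :=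
  open Classical in
  univ.filter fun v => m ≤ #{a : A | flipA a v ∈ Y} ∨ m ≤ #{b : B | flipB b v ∈ Y}

lemma mem_crowded {m : ℝ} {Y : Finset (Vertex G)} {v : Vertex G} :
    v ∈ crowded A B m Y ↔ m ≤ #{a : A | flipA a v ∈ Y} ∨ m ≤ #{b : B | flipB b v ∈ Y} :=
  mem_filter.trans (and_iff_right (mem_univ v))

lemma card_compl_A_le {m : ℝ} {Y : Finset (Vertex G)} {v : Vertex G} (h : v ∉ crowded A B m Y) :
    (#({a : A | flipA a v ∉ Y} : Finset A)ᶜ : ℝ) ≤ m := by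
  rw [mem_crowded, not_or] at h
  simpa only [compl_filter, not_not] using (not_le.1 h.1).le

lemma card_compl_B_le {m : ℝ} {Y : Finset (Vertex G)} {v : Vertex G} (h : v ∉ crowded A B m Y) :
    (#({b : B | flipB b v ∉ Y} : Finset B)ᶜ : ℝ) ≤ m := by
  rw [mem_crowded, not_or] at h
  simpa only [compl_filter, not_not] using (not_le.1 h.2).le

/-- The active vertices whose local codeword `R_i + C_i` has weight larger than `w₀`. -/
noncomputable def Quadruple.exceptional (Z : Quadruple A B) (w₀ : ℝ) : Finset (Vertex G) :=
  open Classical in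
  Z.active.filter fun v => w₀ < weight (Z.rowsAt v + Z.colsAt v)

lemma Quadruple.exceptional_subset (Z : Quadruple A B) (w₀ : ℝ) : Z.exceptional w₀ ⊆ Z.active :=
  filter_subset _ _

/-- The relations between the scales of the argument: `D` is the degree, `d` a lower bound for the
minimum distances, `w` the robustness parameter, `P` the resistance to puncturing, and `f` bounds
the number of nonzero rows and columns at a vertex that is not exceptional. -/
structure Scales (D d w P f : ℝ) : Prop where
  d_pos : 0 < d
  w_pos : 0 < w
  P_nonneg : 0 ≤ P
  f_nonneg : 0 ≤ f
  P_le : P ≤ d / 64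
  div_le : w / (d - P) ≤ d / 64
  f_le : f ≤ d / 64
  mul_f_le : d * f / 2 ≤ w
  noise_le : 2 * D * f ≤ w / 4

/-- The standing assumptions: codes of distance at least `d` with a robust dual tensor code, a
stalled mismatch `z` and a minimal decomposition `Z` of it. -/
structure Setting (D : ℕ) (d w P f : ℝ) (CA : Submodule (ZMod 2) (A → ZMod 2))
    (CB : Submodule (ZMod 2) (B → ZMod 2)) (z : Square A B → ZMod 2) (Z : Quadruple A B) :
    Prop where
  scales : Scales D d w P f
  card_A : #A = D
  card_B : #B = D
  dist_A : d ≤ minDist CA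
  dist_B : d ≤ minDist CB
  robust : RobustResistant w P CA CB
  stalled : Stalled CA CB z
  minimal : Z.IsMinimal CA CB z

variable {CA : Submodule (ZMod 2) (A → ZMod 2)} {CB : Submodule (ZMod 2) (B → ZMod 2)}
  {z : Square A B → ZMod 2} {Z : Quadruple A B} {D : ℕ} {d w P f : ℝ}

lemma Quadruple.IsMinimal.mem_active_of_rowsAt (h : Z.IsMinimal CA CB z) {v : Vertex G}
    (hv : v ∈ V0 G) (h0 : Z.rowsAt v ≠ 0) : v ∈ Z.active := by
  by_contra hna
  exact h0 (h.eq_zero_of_not_active hv hna).1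

lemma Quadruple.IsMinimal.mem_active_of_colsAt (h : Z.IsMinimal CA CB z) {v : Vertex G}
    (hv : v ∈ V0 G) (h0 : Z.colsAt v ≠ 0) : v ∈ Z.active := by
  by_contra hna
  exact h0 (h.eq_zero_of_not_active hv hna).2

/-- Noise on a square at `v ∈ V₀` comes from a row or a column through the opposite vertex. -/
lemma Quadruple.IsMinimal.opposite_mem_active (h : Z.IsMinimal CA CB z) {v : Vertex G}
    (hv : v ∈ V0 G) {a : A} {b : B} (h0 : Z.noiseAt v a b ≠ 0) :
    flipB b (flipA a v) ∈ Z.active := by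
  have hv' : flipB b (flipA a v) ∈ V0 G := flipB_mem_V0.2 (flipA_mem_V1.2 hv)
  have h1 : Z.rowsAt (flipB b v) a b = Z.rowsAt (flipB b (flipA a v)) a b := by
    rw [← flipA_flipB, Z.rowsAt_flipA]
  have h2 : Z.colsAt (flipA a v) a b = Z.colsAt (flipB b (flipA a v)) a b :=
    (Z.colsAt_flipB a b _).symm
  have h3 : Z.noiseAt v a b = Z.rowsAt (flipB b (flipA a v)) a b +
      Z.colsAt (flipB b (flipA a v)) a b := by
    rw [← h1, ← h2]; rfl
  by_cases h4 : Z.rowsAt (flipB b (flipA a v)) a b = 0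
  · refine h.mem_active_of_colsAt hv' fun h5 => h0 ?_
    rw [h3, h4, h5]; rfl
  · exact h.mem_active_of_rowsAt hv' fun h5 => h4 (by rw [h5]; rfl)

namespace Setting

lemma norm_le (h : Setting D d w P f CA CB z Z) (v : Vertex G) {S : Finset A} {T : Finset B}
    {q W : ℝ} (hS : (#Sᶜ : ℝ) ≤ q) (hT : (#Tᶜ : ℝ) ≤ q) (hq : q ≤ P)
    (hW : (weightOn S T (Z.rowsAt v + Z.colsAt v) : ℝ) ≤ W) (hWw : W ≤ w)
    (hlt : q + W / (d - q) < d) :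
    (colNorm (Z.colsAt v) + rowNorm (Z.rowsAt v) : ℝ) ≤ 2 * (q + W / (d - q)) := by
  have hs := h.scales
  obtain ⟨t, ht, h1, h2⟩ := exists_tensor_rowNorm_colNorm_le h.robust
    (by simp [h.card_A, h.card_B]) h.dist_A h.dist_B hS hT hq
    (by linarith [hs.P_le, hs.d_pos]) (h.minimal.1.row_mem v) (h.minimal.1.col_mem v) hW hWw hlt
  have h3 : (colNorm (Z.colsAt v) + rowNorm (Z.rowsAt v) : ℝ) ≤
      colNorm (Z.colsAt v + t) + rowNorm (Z.rowsAt v + t) := by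
    exact_mod_cast h.minimal.le_add v ht
  have h4 : (rowNorm (Z.rowsAt v + t) : ℝ) ≤ q + W / (d - q) := h1
  have h5 : (colNorm (Z.colsAt v + t) : ℝ) ≤ q + W / (d - q) := h2
  linarith

/-- A vertex of `V₀` that is not exceptional carries few rows and columns. -/
lemma norm_le_of_not_exceptional (h : Setting D d w P f CA CB z Z) {v : Vertex G}
    (hv : v ∈ V0 G) (hne : v ∉ Z.exceptional (d * f / 2)) :
    (colNorm (Z.colsAt v) + rowNorm (Z.rowsAt v) : ℝ) ≤ f := by
  have hs := h.scales
  by_cases ha : v ∈ Z.active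
  · have hw : (weight (Z.rowsAt v + Z.colsAt v) : ℝ) ≤ d * f / 2 := by
      by_contra hc
      exact hne (mem_filter.2 ⟨ha, not_le.1 hc⟩)
    have hval : d * f / 2 / (d - 0) = f / 2 := by
      rw [sub_zero]
      field_simp [hs.d_pos.ne']
    have h1 := h.norm_le v (S := univ) (T := univ) (q := 0) (W := d * f / 2) (by simp) (by simp)
      hs.P_nonneg hw hs.mul_f_le (by rw [hval]; linarith [hs.f_le, hs.d_pos])
    rw [hval] at h1
    linarith
  · obtain ⟨h1, h2⟩ := h.minimal.eq_zero_of_not_active hv ha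
    rw [h1, h2, rowNorm_zero, colNorm_zero]
    simpa using hs.f_nonneg

/-- At a non-exceptional vertex of `V₀`, a nonzero row meets noise on nearly half of the minimum
distance, since removing this row does not help the stalled decoder. -/
lemma le_card_noise_row (h : Setting D d w P f CA CB z Z) {v : Vertex G}
    (hv : v ∈ V0 G) (hne : v ∉ Z.exceptional (d * f / 2)) {a : A} (ha : Z.rowsAt v a ≠ 0) :
    d / 2 - f ≤ #{b : B | Z.noiseAt v a b ≠ 0} := by
  have hmem : Z.rowsAt v a ∈ CB := h.minimal.1.row_mem v a
  have h1 := h.stalled.weight_le hv (Submodule.zero_mem _) (rowMatrix_mem a hmem)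
  rw [zero_add] at h1
  have h2 := weight_add_rowMatrix (localView v z) a (Z.rowsAt v a)
  have h3 := hammingNorm_le_two_mul_card (f := localView v z a) (y := Z.rowsAt v a) (by omega)
  have h4 : #{b | Z.rowsAt v a b ≠ 0 ∧ localView v z a b = 0} ≤
      #{b : B | Z.noiseAt v a b ≠ 0} + hammingNorm (Z.colsAt v a) := by
    refine le_trans (card_le_card fun b hb => ?_) (card_union_le _ _)
    obtain ⟨h5, h6⟩ := (mem_filter.1 hb).2
    rw [h.minimal.1.localView_eq v] at h6
    simp only [mem_union, mem_filter, mem_univ, true_and]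
    by_contra! hc
    refine h5 ?_
    have h7 : Z.noiseAt v a b + Z.rowsAt v a b + Z.colsAt v a b = 0 := h6
    rwa [hc.1, hc.2, zero_add, add_zero] at h7
  have h5 := hammingNorm_row_le_colNorm (Z.colsAt v) a
  have h6 := minDist_le_hammingNorm hmem ha
  have h7 := h.norm_le_of_not_exceptional hv hne
  have h8 := h.dist_B
  have h9 : (minDist CB : ℝ) ≤ 2 * (#{b : B | Z.noiseAt v a b ≠ 0} + colNorm (Z.colsAt v)) := by
    exact_mod_cast (by omega :
      minDist CB ≤ 2 * (#{b : B | Z.noiseAt v a b ≠ 0} + colNorm (Z.colsAt v)))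
  have h10 : (0 : ℝ) ≤ rowNorm (Z.rowsAt v) := Nat.cast_nonneg _
  linarith

lemma le_card_noise_col (h : Setting D d w P f CA CB z Z) {v : Vertex G}
    (hv : v ∈ V0 G) (hne : v ∉ Z.exceptional (d * f / 2)) {b : B} (hb : (Z.colsAt v)ᵀ b ≠ 0) :
    d / 2 - f ≤ #{a : A | Z.noiseAt v a b ≠ 0} := by
  have hmem : (Z.colsAt v)ᵀ b ∈ CA := h.minimal.1.col_mem v b
  have h1 := h.stalled.weight_le hv (colMatrix_mem b hmem) (Submodule.zero_mem _)
  rw [add_zero] at h1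
  have h2 := weight_add_colMatrix (localView v z) b ((Z.colsAt v)ᵀ b)
  have h3 := hammingNorm_le_two_mul_card (f := (localView v z)ᵀ b) (y := (Z.colsAt v)ᵀ b)
    (by omega)
  have h4 : #{a | (Z.colsAt v)ᵀ b a ≠ 0 ∧ (localView v z)ᵀ b a = 0} ≤
      #{a : A | Z.noiseAt v a b ≠ 0} + hammingNorm ((Z.rowsAt v)ᵀ b) := by
    refine le_trans (card_le_card fun a ha => ?_) (card_union_le _ _)
    obtain ⟨h5, h6⟩ := (mem_filter.1 ha).2
    rw [h.minimal.1.localView_eq v] at h6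
    simp only [mem_union, mem_filter, mem_univ, true_and]
    by_contra! hc
    refine h5 ?_
    have h7 : Z.noiseAt v a b + (Z.rowsAt v)ᵀ b a + (Z.colsAt v)ᵀ b a = 0 := h6
    rwa [hc.1, hc.2, zero_add, zero_add] at h7
  have h5 := hammingNorm_col_le_rowNorm (Z.rowsAt v) b
  have h6 := minDist_le_hammingNorm hmem hb
  have h7 := h.norm_le_of_not_exceptional hv hne
  have h8 := h.dist_A
  have h9 : (minDist CA : ℝ) ≤ 2 * (#{a : A | Z.noiseAt v a b ≠ 0} + rowNorm (Z.rowsAt v)) := by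
    exact_mod_cast (by omega :
      minDist CA ≤ 2 * (#{a : A | Z.noiseAt v a b ≠ 0} + rowNorm (Z.rowsAt v)))
  have h10 : (0 : ℝ) ≤ colNorm (Z.colsAt v) := Nat.cast_nonneg _
  linarith

/-- A row at a non-exceptional vertex of `V₀` leads to a vertex of `V₁` with many active
neighbours. -/
lemma flipA_mem_crowded (h : Setting D d w P f CA CB z Z) {v : Vertex G}
    (hv : v ∈ V0 G) (hne : v ∉ Z.exceptional (d * f / 2)) {a : A} (ha : Z.rowsAt v a ≠ 0) :
    flipA a v ∈ crowded A B (d / 4) Z.active := by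
  refine mem_crowded.2 (Or.inr ?_)
  have h1 := h.le_card_noise_row hv hne ha
  have h2 : (#{b : B | Z.noiseAt v a b ≠ 0} : ℝ) ≤ #{b : B | flipB b (flipA a v) ∈ Z.active} := by
    exact_mod_cast card_le_card (monotone_filter_right _
      fun b _ hb => h.minimal.opposite_mem_active hv hb)
  linarith [h.scales.f_le, h.scales.d_pos]

lemma flipB_mem_crowded (h : Setting D d w P f CA CB z Z) {v : Vertex G}
    (hv : v ∈ V0 G) (hne : v ∉ Z.exceptional (d * f / 2)) {b : B} (hb : (Z.colsAt v)ᵀ b ≠ 0) :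
    flipB b v ∈ crowded A B (d / 4) Z.active := by
  refine mem_crowded.2 (Or.inl ?_)
  have h1 := h.le_card_noise_col hv hne hb
  have h2 : (#{a : A | Z.noiseAt v a b ≠ 0} : ℝ) ≤ #{a : A | flipA a (flipB b v) ∈ Z.active} := by
    exact_mod_cast card_le_card (monotone_filter_right _
      fun a _ ha => by rw [flipA_flipB]; exact h.minimal.opposite_mem_active hv ha)
  linarith [h.scales.f_le, h.scales.d_pos]

/-- An exceptional vertex has many active opposite vertices, because the stalled decoder gains
nothing from removing the whole local codeword. -/
lemma le_card_opposite (h : Setting D d w P f CA CB z Z) {v : Vertex G}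
    (hv : v ∈ Z.exceptional (d * f / 2)) :
    d * f / 4 ≤ #{q : A × B | flipB q.2 (flipA q.1 v) ∈ Z.active} := by
  have hv0 : v ∈ V0 G := (Quadruple.mem_active.1 (Z.exceptional_subset _ hv)).1
  have hw : d * f / 2 < weight (Z.rowsAt v + Z.colsAt v) := (mem_filter.1 hv).2
  have h1 := h.stalled.weight_le hv0 (h.minimal.1.col_mem v) (h.minimal.1.row_mem v)
  have h2 : localView v z + (localView v (Z.C v.2.2) + localView v (Z.R v.2.1)) =
      localView v z + (Z.rowsAt v + Z.colsAt v) := by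
    rw [add_comm (localView v (Z.C v.2.2))]; rfl
  rw [h2, weight_eq_hammingNorm, weight_eq_hammingNorm] at h1
  have h3 := hammingNorm_le_two_mul_card (y := fun q : A × B => (Z.rowsAt v + Z.colsAt v) q.1 q.2)
    h1
  rw [← weight_eq_hammingNorm (Z.rowsAt v + Z.colsAt v)] at h3
  have h4 : #{q : A × B | (Z.rowsAt v + Z.colsAt v) q.1 q.2 ≠ 0 ∧ localView v z q.1 q.2 = 0} ≤
      #{q : A × B | flipB q.2 (flipA q.1 v) ∈ Z.active} := by
    refine card_le_card (monotone_filter_right _ fun q _ hq => ?_)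
    obtain ⟨h5, h6⟩ := hq
    refine h.minimal.opposite_mem_active hv0 fun h7 => h5 ?_
    rw [h.minimal.1.localView_eq v, add_assoc] at h6
    have h8 : Z.noiseAt v q.1 q.2 + (Z.rowsAt v + Z.colsAt v) q.1 q.2 = 0 := h6
    rwa [h7, zero_add] at h8
  have h5 : (weight (Z.rowsAt v + Z.colsAt v) : ℝ) ≤
      2 * #{q : A × B | flipB q.2 (flipA q.1 v) ∈ Z.active} := by
    exact_mod_cast h3.trans (Nat.mul_le_mul_left 2 h4)
  linarith

/-- If a row of `v` meets many rows of its `B`-neighbours, then its other endpoint has many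
neighbours which themselves have many active neighbours. -/
lemma flipA_mem_crowded_crowded (h : Setting D d w P f CA CB z Z) {v : Vertex G}
    (hv : v ∈ V1 G) (hD : v ∉ crowded A B (P / 2) (Z.exceptional (d * f / 2))) {a : A}
    (ha : 3 * d / 16 ≤ #{b : B | Z.rowsAt (flipB b v) a b ≠ 0}) :
    flipA a v ∈ crowded A B (d / 16) (crowded A B (d / 4) Z.active) := by
  rw [mem_crowded, not_or] at hD
  refine mem_crowded.2 (Or.inr ?_)
  have h1 : #{b : B | Z.rowsAt (flipB b v) a b ≠ 0} ≤
      #{b : B | flipB b v ∈ Z.exceptional (d * f / 2)} +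
        #{b : B | flipB b (flipA a v) ∈ crowded A B (d / 4) Z.active} := by
    refine le_trans (card_le_card fun b hb => ?_) (card_union_le _ _)
    rw [mem_union, mem_filter, mem_filter, ← flipA_flipB]
    by_cases h2 : flipB b v ∈ Z.exceptional (d * f / 2)
    · exact Or.inl ⟨mem_univ _, h2⟩
    · refine Or.inr ⟨mem_univ _, h.flipA_mem_crowded (flipB_mem_V0.2 hv) h2 fun h3 => ?_⟩
      exact (mem_filter.1 hb).2 (congrFun h3 b)
  have h2 : (#{b : B | Z.rowsAt (flipB b v) a b ≠ 0} : ℝ) ≤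
      #{b : B | flipB b v ∈ Z.exceptional (d * f / 2)} +
        #{b : B | flipB b (flipA a v) ∈ crowded A B (d / 4) Z.active} := by exact_mod_cast h1
  have hs := h.scales
  linarith [hs.P_le, hs.d_pos, hD.2]

lemma flipB_mem_crowded_crowded (h : Setting D d w P f CA CB z Z) {v : Vertex G}
    (hv : v ∈ V1 G) (hD : v ∉ crowded A B (P / 2) (Z.exceptional (d * f / 2))) {b : B}
    (hb : 3 * d / 16 ≤ #{a : A | Z.colsAt (flipA a v) a b ≠ 0}) :
    flipB b v ∈ crowded A B (d / 16) (crowded A B (d / 4) Z.active) := by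
  rw [mem_crowded, not_or] at hD
  refine mem_crowded.2 (Or.inl ?_)
  have h1 : #{a : A | Z.colsAt (flipA a v) a b ≠ 0} ≤
      #{a : A | flipA a v ∈ Z.exceptional (d * f / 2)} +
        #{a : A | flipA a (flipB b v) ∈ crowded A B (d / 4) Z.active} := by
    refine le_trans (card_le_card fun a ha => ?_) (card_union_le _ _)
    rw [mem_union, mem_filter, mem_filter, flipA_flipB]
    by_cases h2 : flipA a v ∈ Z.exceptional (d * f / 2)
    · exact Or.inl ⟨mem_univ _, h2⟩
    · refine Or.inr ⟨mem_univ _, h.flipB_mem_crowded (flipA_mem_V0.2 hv) h2 fun h3 => ?_⟩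
      exact (mem_filter.1 ha).2 (congrFun h3 a)
  have h2 : (#{a : A | Z.colsAt (flipA a v) a b ≠ 0} : ℝ) ≤
      #{a : A | flipA a v ∈ Z.exceptional (d * f / 2)} +
        #{a : A | flipA a (flipB b v) ∈ crowded A B (d / 4) Z.active} := by exact_mod_cast h1
  have hs := h.scales
  linarith [hs.P_le, hs.d_pos, hD.1]

/-- Outside the rows and columns leading to exceptional vertices, the noise at a vertex of `V₁` is
small. -/
lemma weightOn_noiseAt_le (h : Setting D d w P f CA CB z Z) {v : Vertex G} (hv : v ∈ V1 G) :
    (weightOn {a : A | flipA a v ∉ Z.exceptional (d * f / 2)}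
      {b : B | flipB b v ∉ Z.exceptional (d * f / 2)} (Z.noiseAt v) : ℝ) ≤ w / 4 := by
  set S : Finset A := {a : A | flipA a v ∉ Z.exceptional (d * f / 2)} with hS
  set T : Finset B := {b : B | flipB b v ∉ Z.exceptional (d * f / 2)} with hT
  let N₁ : Matrix A B (ZMod 2) := Matrix.of fun a b => Z.rowsAt (flipB b v) a b
  let N₂ : Matrix A B (ZMod 2) := Matrix.of fun a b => Z.colsAt (flipA a v) a b
  have hN : Z.noiseAt v = N₁ + N₂ := rfl
  have h1 : (weightOn S T N₁ : ℝ) ≤ D * f := by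
    rw [← weightOn_transpose, weightOn_eq_sum_rows]
    push_cast
    calc ∑ b ∈ T, (#(S.filter fun a => N₁ᵀ b a ≠ 0) : ℝ) ≤ ∑ b ∈ T, f := by
          refine sum_le_sum fun b hb => ?_
          have h2 := h.norm_le_of_not_exceptional (flipB_mem_V0.2 hv) (mem_filter.1 hb).2
          have h3 : #(S.filter fun a => N₁ᵀ b a ≠ 0) ≤ rowNorm (Z.rowsAt (flipB b v)) :=
            (card_le_card (filter_subset_filter _ (subset_univ S))).trans
              (hammingNorm_col_le_rowNorm (Z.rowsAt (flipB b v)) b)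
          have h4 : (#(S.filter fun a => N₁ᵀ b a ≠ 0) : ℝ) ≤ rowNorm (Z.rowsAt (flipB b v)) := by
            exact_mod_cast h3
          have h5 : (0 : ℝ) ≤ colNorm (Z.colsAt (flipB b v)) := Nat.cast_nonneg _
          linarith
      _ = #T * f := by rw [sum_const, nsmul_eq_mul]
      _ ≤ D * f := by
          refine mul_le_mul_of_nonneg_right ?_ h.scales.f_nonneg
          have := card_le_univ T
          rw [Fintype.card_coe, h.card_B] at this
          exact_mod_cast this
  have h2 : (weightOn S T N₂ : ℝ) ≤ D * f := by
    rw [weightOn_eq_sum_rows]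
    push_cast
    calc ∑ a ∈ S, (#(T.filter fun b => N₂ a b ≠ 0) : ℝ) ≤ ∑ a ∈ S, f := by
          refine sum_le_sum fun a ha => ?_
          have h2 := h.norm_le_of_not_exceptional (flipA_mem_V0.2 hv) (mem_filter.1 ha).2
          have h3 : #(T.filter fun b => N₂ a b ≠ 0) ≤ colNorm (Z.colsAt (flipA a v)) :=
            (card_le_card (filter_subset_filter _ (subset_univ T))).trans
              (hammingNorm_row_le_colNorm (Z.colsAt (flipA a v)) a)
          have h4 : (#(T.filter fun b => N₂ a b ≠ 0) : ℝ) ≤ colNorm (Z.colsAt (flipA a v)) := by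
            exact_mod_cast h3
          have h5 : (0 : ℝ) ≤ rowNorm (Z.rowsAt (flipA a v)) := Nat.cast_nonneg _
          linarith
      _ = #S * f := by rw [sum_const, nsmul_eq_mul]
      _ ≤ D * f := by
          refine mul_le_mul_of_nonneg_right ?_ h.scales.f_nonneg
          have := card_le_univ S
          rw [Fintype.card_coe, h.card_A] at this
          exact_mod_cast this
  have h3 : (weightOn S T (N₁ + N₂) : ℝ) ≤ weightOn S T N₁ + weightOn S T N₂ := by
    exact_mod_cast weightOn_add_le S T N₁ N₂
  rw [hN]
  linarith [h.scales.noise_le]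

/-- A vertex of `V₁` with few exceptional neighbours that the decoder does not identify carries few
rows and columns: otherwise its own codeword would meet the criteria of the decoder. -/
lemma norm_le_of_not_identified (h : Setting D d w P f CA CB z Z) {v : Vertex G}
    (hv : v ∈ V1 G) (hD : v ∉ crowded A B (P / 2) (Z.exceptional (d * f / 2)))
    (hid : ¬ Identified w P CA CB (localView v z)) :
    (colNorm (Z.colsAt v) + rowNorm (Z.rowsAt v) : ℝ) ≤ d / 16 := by
  have hs := h.scales
  have hS := card_compl_A_le hD
  have hT := card_compl_B_le hD
  have hN := h.weightOn_noiseAt_le hv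
  set S : Finset A := {a : A | flipA a v ∉ Z.exceptional (d * f / 2)}
  set T : Finset B := {b : B | flipB b v ∉ Z.exceptional (d * f / 2)}
  have hz := h.minimal.1.localView_eq v
  have hW : (weightOn S T (Z.rowsAt v + Z.colsAt v) : ℝ) ≤ w := by
    by_contra hc
    rw [not_le] at hc
    have h1 : localView v z + Z.rowsAt v + Z.colsAt v = Z.noiseAt v := by
      have e : Z.noiseAt v + Z.rowsAt v + Z.colsAt v + Z.rowsAt v + Z.colsAt v = Z.noiseAt v +
        (Z.rowsAt v + Z.rowsAt v) + (Z.colsAt v + Z.colsAt v) := by abel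
      rw [hz, e, ZModModule.add_self, ZModModule.add_self, add_zero, add_zero]
    have h2 : Z.rowsAt v + Z.colsAt v = localView v z + Z.noiseAt v := by
      rw [hz, add_comm _ (Z.noiseAt v), ← add_assoc, ← add_assoc, ZModModule.add_self, zero_add]
    refine hid ⟨S, T, Z.rowsAt v, Z.colsAt v, hS, hT, h.minimal.1.row_mem v,
      h.minimal.1.col_mem v, ?_, hc, ?_⟩
    · have h3 : (weightOn S T (Z.rowsAt v + Z.colsAt v) : ℝ) ≤
          weightOn S T (localView v z) + weightOn S T (Z.noiseAt v) := by
        rw [h2]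
        exact_mod_cast weightOn_add_le S T _ _
      linarith [hs.w_pos]
    · rw [h1]
      linarith [hs.w_pos]
  have h1 := h.norm_le v (q := P) (by linarith [hs.P_nonneg]) (by linarith [hs.P_nonneg]) le_rfl
    hW le_rfl (by linarith [hs.P_le, hs.div_le, hs.d_pos])
  linarith [hs.P_le, hs.div_le, hs.d_pos]

lemma flipA_mem_of_not_identified (h : Setting D d w P f CA CB z Z) {v : Vertex G}
    (hv : v ∈ V1 G) (hD : v ∉ crowded A B (P / 2) (Z.exceptional (d * f / 2)))
    (hid : ¬ Identified w P CA CB (localView v z)) {a : A} (ha : Z.rowsAt v a ≠ 0) :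
    flipA a v ∈ Z.exceptional (d * f / 2) ∪
      crowded A B (d / 16) (crowded A B (d / 4) Z.active) := by
  by_cases hne : flipA a v ∈ Z.exceptional (d * f / 2)
  · exact mem_union_left _ hne
  refine mem_union_right _ (h.flipA_mem_crowded_crowded hv hD ?_)
  have hs := h.scales
  have h1 := h.le_card_noise_row (flipA_mem_V0.2 hv) hne (a := a) (by rwa [Z.rowsAt_flipA])
  have h2 := h.norm_le_of_not_identified hv hD hid
  have h3 : #{b : B | Z.noiseAt (flipA a v) a b ≠ 0} ≤
      #{b : B | Z.rowsAt (flipB b v) a b ≠ 0} + hammingNorm (Z.colsAt v a) := by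
    refine le_trans (card_le_card fun b hb => ?_) (card_union_le _ _)
    have h4 : Z.noiseAt (flipA a v) a b = Z.rowsAt (flipB b v) a b + Z.colsAt v a b := by
      change Z.rowsAt (flipB b (flipA a v)) a b + Z.colsAt (flipA a (flipA a v)) a b = _
      rw [flipA_flipA, ← flipA_flipB, Z.rowsAt_flipA]
    have h5 := (mem_filter.1 hb).2
    rw [h4] at h5
    simp only [mem_union, mem_filter, mem_univ, true_and]
    by_contra! hc
    rw [hc.1, hc.2, add_zero] at h5
    exact h5 rfl
  have h4 := h3.trans (Nat.add_le_add_left (hammingNorm_row_le_colNorm (Z.colsAt v) a) _)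
  have h5 : (#{b : B | Z.noiseAt (flipA a v) a b ≠ 0} : ℝ) ≤
      #{b : B | Z.rowsAt (flipB b v) a b ≠ 0} + colNorm (Z.colsAt v) := by exact_mod_cast h4
  have h6 : (0 : ℝ) ≤ rowNorm (Z.rowsAt v) := Nat.cast_nonneg _
  linarith [hs.f_le, hs.d_pos]

lemma flipB_mem_of_not_identified (h : Setting D d w P f CA CB z Z) {v : Vertex G}
    (hv : v ∈ V1 G) (hD : v ∉ crowded A B (P / 2) (Z.exceptional (d * f / 2)))
    (hid : ¬ Identified w P CA CB (localView v z)) {b : B} (hb : (Z.colsAt v)ᵀ b ≠ 0) :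
    flipB b v ∈ Z.exceptional (d * f / 2) ∪
      crowded A B (d / 16) (crowded A B (d / 4) Z.active) := by
  by_cases hne : flipB b v ∈ Z.exceptional (d * f / 2)
  · exact mem_union_left _ hne
  refine mem_union_right _ (h.flipB_mem_crowded_crowded hv hD ?_)
  have hs := h.scales
  have h1 := h.le_card_noise_col (flipB_mem_V0.2 hv) hne (b := b)
    (by rwa [Z.colsAt_transpose_flipB])
  have h2 := h.norm_le_of_not_identified hv hD hid
  have h3 : #{a : A | Z.noiseAt (flipB b v) a b ≠ 0} ≤
      #{a : A | Z.colsAt (flipA a v) a b ≠ 0} + hammingNorm ((Z.rowsAt v)ᵀ b) := by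
    refine le_trans (card_le_card fun a ha => ?_) (card_union_le _ _)
    have h4 : Z.noiseAt (flipB b v) a b = Z.rowsAt v a b + Z.colsAt (flipA a v) a b := by
      change Z.rowsAt (flipB b (flipB b v)) a b + Z.colsAt (flipA a (flipB b v)) a b = _
      rw [flipB_flipB, flipA_flipB, Z.colsAt_flipB]
    have h5 := (mem_filter.1 ha).2
    rw [h4] at h5
    simp only [mem_union, mem_filter, mem_univ, true_and]
    by_contra! hc
    have h6 : Z.rowsAt v a b = 0 := hc.2
    rw [hc.1, h6, add_zero] at h5
    exact h5 rfl
  have h4 := h3.trans (Nat.add_le_add_left (hammingNorm_col_le_rowNorm (Z.rowsAt v) b) _)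
  have h5 : (#{a : A | Z.noiseAt (flipB b v) a b ≠ 0} : ℝ) ≤
      #{a : A | Z.colsAt (flipA a v) a b ≠ 0} + rowNorm (Z.rowsAt v) := by exact_mod_cast h4
  have h6 : (0 : ℝ) ≤ colNorm (Z.colsAt v) := Nat.cast_nonneg _
  linarith [hs.f_le, hs.d_pos]

end Setting

end Setting

/-! ### The decoding step at typical vertices -/

section Decoding

variable {G : Type*} [Group G] [Fintype G] [DecidableEq G] {A B : Finset G}
  {CA : Submodule (ZMod 2) (A → ZMod 2)} {CB : Submodule (ZMod 2) (B → ZMod 2)}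
  {z : Square A B → ZMod 2} {Z : Quadruple A B} {D : ℕ} {d w P f : ℝ}

namespace Setting

lemma card_heavy_le (h : Setting D d w P f CA CB z Z) {v : Vertex G} (hv : v ∈ V1 G)
    (hD : v ∉ crowded A B (P / 2) (Z.exceptional (d * f / 2))) :
    (#{a | d / 4 < hammingNorm (Z.noiseAt v a)} : ℝ) ≤ d / 16 ∧
      (#{b | d / 4 < hammingNorm ((Z.noiseAt v)ᵀ b)} : ℝ) ≤ d / 16 := by
  have hs := h.scales
  have hS := card_compl_A_le hD
  have hT := card_compl_B_le hD
  have hN := h.weightOn_noiseAt_le hv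
  have hPd : P / 2 ≤ d / 8 := by linarith [hs.P_le, hs.d_pos]
  have hval : P / 2 + w / 4 / (d / 8) ≤ d / 16 := by
    have h1 : w / d ≤ w / (d - P) :=
      div_le_div_of_nonneg_left hs.w_pos.le (by linarith [hs.P_le, hs.d_pos])
        (by linarith [hs.P_nonneg])
    have h2 : w / 4 / (d / 8) = 2 * (w / d) := by
      have := hs.d_pos.ne'
      field_simp
      ring
    linarith [hs.div_le, hs.P_le, hs.d_pos]
  refine ⟨(card_heavy_rows_le hS hT hN hs.d_pos hPd).trans hval,
    (card_heavy_rows_le hT hS ?_ hs.d_pos hPd).trans hval⟩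
  rw [weightOn_transpose]
  exact hN

/-- A heavily noisy row of a vertex of `V₁` with few exceptional neighbours leads to an exceptional
vertex, or to one with many neighbours which themselves have many active neighbours. -/
lemma flipA_mem_of_heavy (h : Setting D d w P f CA CB z Z) {v : Vertex G}
    (hv : v ∈ V1 G) (hD : v ∉ crowded A B (P / 2) (Z.exceptional (d * f / 2))) {a : A}
    (ha : d / 4 ≤ hammingNorm (Z.noiseAt v a)) :
    flipA a v ∈ Z.exceptional (d * f / 2) ∪
      crowded A B (d / 16) (crowded A B (d / 4) Z.active) := by
  by_cases hne : flipA a v ∈ Z.exceptional (d * f / 2)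
  · exact mem_union_left _ hne
  refine mem_union_right _ (h.flipA_mem_crowded_crowded hv hD ?_)
  have h1 := h.norm_le_of_not_exceptional (flipA_mem_V0.2 hv) hne
  have h2 : hammingNorm (Z.noiseAt v a) ≤ #{b : B | Z.rowsAt (flipB b v) a b ≠ 0} +
      hammingNorm (Z.colsAt (flipA a v) a) :=
    hammingNorm_add_le (fun b => Z.rowsAt (flipB b v) a b) (Z.colsAt (flipA a v) a)
  have h3 := h2.trans
    (Nat.add_le_add_left (hammingNorm_row_le_colNorm (Z.colsAt (flipA a v)) a) _)
  have h4 : (hammingNorm (Z.noiseAt v a) : ℝ) ≤ #{b : B | Z.rowsAt (flipB b v) a b ≠ 0} +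
      colNorm (Z.colsAt (flipA a v)) := by exact_mod_cast h3
  have h5 : (0 : ℝ) ≤ rowNorm (Z.rowsAt (flipA a v)) := Nat.cast_nonneg _
  linarith [h.scales.f_le, h.scales.d_pos]

lemma flipB_mem_of_heavy (h : Setting D d w P f CA CB z Z) {v : Vertex G}
    (hv : v ∈ V1 G) (hD : v ∉ crowded A B (P / 2) (Z.exceptional (d * f / 2))) {b : B}
    (hb : d / 4 ≤ hammingNorm ((Z.noiseAt v)ᵀ b)) :
    flipB b v ∈ Z.exceptional (d * f / 2) ∪
      crowded A B (d / 16) (crowded A B (d / 4) Z.active) := by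
  by_cases hne : flipB b v ∈ Z.exceptional (d * f / 2)
  · exact mem_union_left _ hne
  refine mem_union_right _ (h.flipB_mem_crowded_crowded hv hD ?_)
  have h1 := h.norm_le_of_not_exceptional (flipB_mem_V0.2 hv) hne
  have h2 : hammingNorm ((Z.noiseAt v)ᵀ b) ≤ hammingNorm ((Z.rowsAt (flipB b v))ᵀ b) +
      #{a : A | Z.colsAt (flipA a v) a b ≠ 0} :=
    hammingNorm_add_le ((Z.rowsAt (flipB b v))ᵀ b) fun a => Z.colsAt (flipA a v) a b
  have h3 := h2.trans
    (Nat.add_le_add_right (hammingNorm_col_le_rowNorm (Z.rowsAt (flipB b v)) b) _)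
  have h4 : (hammingNorm ((Z.noiseAt v)ᵀ b) : ℝ) ≤ rowNorm (Z.rowsAt (flipB b v)) +
      #{a : A | Z.colsAt (flipA a v) a b ≠ 0} := by exact_mod_cast h3
  have h5 : (0 : ℝ) ≤ colNorm (Z.colsAt (flipB b v)) := Nat.cast_nonneg _
  linarith [h.scales.f_le, h.scales.d_pos]

/-- At an identified vertex of `V₁` with few exceptional neighbours, the update agrees with the
codeword of the vertex, up to a tensor codeword, except on few rows and columns; the line moves
then clear all of these except those leading to atypical vertices of `V₀`. -/
lemma exists_tensor_of_outcome (h : Setting D d w P f CA CB z Z) {v : Vertex G}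
    (hv : v ∈ V1 G) (hD : v ∉ crowded A B (P / 2) (Z.exceptional (d * f / 2)))
    {u : Matrix A B (ZMod 2) × Matrix A B (ZMod 2)}
    (hu : LocalOutcome w P CA CB (localView v z) u) :
    ∃ t ∈ tensorCode CA CB,
      (∀ a, (Z.rowsAt v + (u.1 + t)) a ≠ 0 → flipA a v ∈ Z.exceptional (d * f / 2) ∪
        crowded A B (d / 16) (crowded A B (d / 4) Z.active)) ∧
      ∀ b, (Z.colsAt v + (u.2 + t))ᵀ b ≠ 0 → flipB b v ∈ Z.exceptional (d * f / 2) ∪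
        crowded A B (d / 16) (crowded A B (d / 4) Z.active) := by
  obtain ⟨⟨A₀, B₀, r, c, hid, hgen⟩, hend⟩ := hu
  have hs := h.scales
  have hd := hs.d_pos
  have hS := card_compl_A_le hD
  have hT := card_compl_B_le hD
  have hN := h.weightOn_noiseAt_le hv
  have hheavy := h.card_heavy_le hv hD
  set S : Finset A := {a : A | flipA a v ∉ Z.exceptional (d * f / 2)}
  set T : Finset B := {b : B | flipB b v ∉ Z.exceptional (d * f / 2)}
  set N := Z.noiseAt v with hNdef
  set R := Z.rowsAt v with hR
  set C := Z.colsAt v with hC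
  have hRm : R ∈ rowCode CB := h.minimal.1.row_mem v
  have hCm : C ∈ columnCode CA := h.minimal.1.col_mem v
  have hz : localView v z = N + R + C := h.minimal.1.localView_eq v
  -- The word found by the decoder is close to the codeword of `v` on a common rectangle.
  have hW : (weightOn (S ∩ A₀) (T ∩ B₀) (R + r + (C + c)) : ℝ) ≤ w := by
    have h1 : R + r + (C + c) = localView v z + r + c + N := by
      have e : N + R + C + r + c + N = R + r + (C + c) + (N + N) := by abel
      rw [hz, e, ZModModule.add_self, add_zero]
    have h2 : weightOn (S ∩ A₀) (T ∩ B₀) (R + r + (C + c)) ≤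
        weightOn A₀ B₀ (localView v z + r + c) + weightOn S T N := by
      rw [h1]
      exact (weightOn_add_le _ _ _ _).trans
        (add_le_add (weightOn_mono inter_subset_right inter_subset_right _)
          (weightOn_mono inter_subset_left inter_subset_left _))
    have h3 : (weightOn (S ∩ A₀) (T ∩ B₀) (R + r + (C + c)) : ℝ) ≤
        weightOn A₀ B₀ (localView v z + r + c) + weightOn S T N := by exact_mod_cast h2
    linarith [hid.weight_after, hs.w_pos]
  have hSc : (#(S ∩ A₀)ᶜ : ℝ) ≤ P := by
    have h1 : #(S ∩ A₀)ᶜ ≤ #Sᶜ + #A₀ᶜ := by rw [compl_inter]; exact card_union_le _ _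
    have h2 : (#(S ∩ A₀)ᶜ : ℝ) ≤ #Sᶜ + #A₀ᶜ := by exact_mod_cast h1
    linarith [hid.card_A]
  have hTc : (#(T ∩ B₀)ᶜ : ℝ) ≤ P := by
    have h1 : #(T ∩ B₀)ᶜ ≤ #Tᶜ + #B₀ᶜ := by rw [compl_inter]; exact card_union_le _ _
    have h2 : (#(T ∩ B₀)ᶜ : ℝ) ≤ #Tᶜ + #B₀ᶜ := by exact_mod_cast h1
    linarith [hid.card_B]
  obtain ⟨t, ht, hrow, hcol⟩ := exists_tensor_rowNorm_colNorm_le h.robust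
    (by simp [h.card_A, h.card_B]) h.dist_A h.dist_B hSc hTc le_rfl (by linarith [hs.P_le])
    ((rowCode CB).add_mem hRm hid.mem_row) ((columnCode CA).add_mem hCm hid.mem_col) hW le_rfl
    (by linarith [hs.P_le, hs.div_le])
  -- The rows and columns on which something can still happen during the line moves.
  set K : Finset A := ({a | d / 4 < hammingNorm (N a)} : Finset A) ∪
    ({a | (fun b => (R + r + t) a b) ≠ 0} : Finset A) with hK
  set L : Finset B := ({b | d / 4 < hammingNorm (Nᵀ b)} : Finset B) ∪
    ({b | (fun a => (C + c + t) a b) ≠ 0} : Finset B) with hL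
  have hKc : (#K : ℝ) ≤ d / 8 := by
    have h1 : #K ≤ #{a | d / 4 < hammingNorm (N a)} + rowNorm (R + r + t) := card_union_le _ _
    have h2 : (#K : ℝ) ≤ #{a | d / 4 < hammingNorm (N a)} + rowNorm (R + r + t) := by
      exact_mod_cast h1
    linarith [hheavy.1, hs.P_le, hs.div_le]
  have hLc : (#L : ℝ) ≤ d / 8 := by
    have h1 : #L ≤ #{b | d / 4 < hammingNorm (Nᵀ b)} + colNorm (C + c + t) := card_union_le _ _
    have h2 : (#L : ℝ) ≤ #{b | d / 4 < hammingNorm (Nᵀ b)} + colNorm (C + c + t) := by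
      exact_mod_cast h1
    linarith [hheavy.2, hs.P_le, hs.div_le]
  have hlight : LightOutside CA CB K L N := by
    refine ⟨fun a ha => ?_, fun b hb => ?_⟩
    · have h1 : (hammingNorm (N a) : ℝ) ≤ d / 4 := by
        by_contra hc
        exact ha (mem_union_left _ (mem_filter.2 ⟨mem_univ _, not_le.1 hc⟩))
      have h2 : (2 * (hammingNorm (N a) + #L) : ℝ) ≤ minDist CB := by linarith [h.dist_B]
      exact_mod_cast h2
    · have h1 : (hammingNorm (Nᵀ b) : ℝ) ≤ d / 4 := by
        by_contra hc
        exact hb (mem_union_left _ (mem_filter.2 ⟨mem_univ _, not_le.1 hc⟩))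
      have h2 : (2 * (hammingNorm (Nᵀ b) + #K) : ℝ) ≤ minDist CA := by linarith [h.dist_A]
      exact_mod_cast h2
  have hshift : localView v z = N + (R + t) + (C + t) := by
    have e : N + (R + t) + (C + t) = N + R + C + (t + t) := by abel
    rw [hz, e, ZModModule.add_self, add_zero]
  have hinit : Confined CA CB K L (R + t + r, C + t + c) := by
    refine ⟨(rowCode CB).add_mem ((rowCode CB).add_mem hRm ht.2) hid.mem_row,
      (columnCode CA).add_mem ((columnCode CA).add_mem hCm ht.1) hid.mem_col, fun a ha => ?_,
      fun b hb => ?_⟩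
    · by_contra h0
      refine ha (mem_union_right _ (mem_filter.2 ⟨mem_univ _, ?_⟩))
      rw [add_right_comm R r t]
      exact h0
    · by_contra h0
      refine hb (mem_union_right _ (mem_filter.2 ⟨mem_univ _, ?_⟩))
      rw [add_right_comm C c t]
      exact h0
  have hfinal : Confined CA CB K L (R + t + u.1, C + t + u.2) :=
    hinit.reflTransGen hlight (hgen.lift (fun u => (R + t + u.1, C + t + u.2))
      fun _ _ hm => hm.shift hshift)
  have hend' : ∀ u', ¬ LineMove CA CB N (R + t + u.1, C + t + u.2) u' := by
    intro u' hm
    -- Shifting back by the same matrices, which are their own negatives.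
    have h1 := hm.shift (N := localView v z) (x := R + t) (y := C + t) (by
      have e : N + (R + t) + (C + t) + (R + t) + (C + t) =
        N + ((R + t) + (R + t)) + ((C + t) + (C + t)) := by abel
      rw [hshift, e, ZModModule.add_self, ZModModule.add_self, add_zero, add_zero])
    dsimp only at h1
    rw [← add_assoc (R + t), ← add_assoc (C + t), ZModModule.add_self, ZModModule.add_self,
      zero_add, zero_add] at h1
    exact hend _ h1
  refine ⟨t, ht, fun a ha => h.flipA_mem_of_heavy hv hD ?_,
    fun b hb => h.flipB_mem_of_heavy hv hD ?_⟩
  · have h1 : ¬ 2 * (hammingNorm (N a) + #L) < minDist CB := by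
      intro h1
      refine ha ?_
      rw [add_comm u.1 t, ← add_assoc]
      exact hfinal.row_eq_zero hend' h1
    have h2 : (minDist CB : ℝ) ≤ 2 * (hammingNorm (N a) + #L) := by exact_mod_cast not_lt.1 h1
    linarith [h.dist_B]
  · have h1 : ¬ 2 * (hammingNorm (Nᵀ b) + #K) < minDist CA := by
      intro h1
      refine hb ?_
      rw [add_comm u.2 t, ← add_assoc]
      exact hfinal.col_eq_zero hend' h1
    have h2 : (minDist CA : ℝ) ≤ 2 * (hammingNorm (Nᵀ b) + #K) := by exact_mod_cast not_lt.1 h1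
    linarith [h.dist_A]

/-- For suitable tensor codewords, the rows and columns that survive the decoding step at a vertex
of `V₁` with few exceptional neighbours all lead to atypical vertices of `V₀`. -/
lemma exists_tensor (h : Setting D d w P f CA CB z Z)
    {u : Vertex G → Matrix A B (ZMod 2) × Matrix A B (ZMod 2)}
    (hu : FirstParallelStep w P CA CB z u) (v : Vertex G) :
    ∃ t ∈ tensorCode CA CB, (¬ Identified w P CA CB (localView v z) → t = 0) ∧
      (v ∈ V1 G → v ∉ crowded A B (P / 2) (Z.exceptional (d * f / 2)) →
        (∀ a, (Z.rowsAt v + ((u v).1 + t)) a ≠ 0 → flipA a v ∈ Z.exceptional (d * f / 2) ∪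
          crowded A B (d / 16) (crowded A B (d / 4) Z.active)) ∧
        ∀ b, (Z.colsAt v + ((u v).2 + t))ᵀ b ≠ 0 → flipB b v ∈ Z.exceptional (d * f / 2) ∪
          crowded A B (d / 16) (crowded A B (d / 4) Z.active)) := by
  by_cases hv : v ∈ V1 G ∧ v ∉ crowded A B (P / 2) (Z.exceptional (d * f / 2))
  · obtain ⟨hv, hD⟩ := hv
    by_cases hid : Identified w P CA CB (localView v z)
    · obtain ⟨t, ht, h1⟩ := h.exists_tensor_of_outcome hv hD ((hu v hv).1 hid)
      exact ⟨t, ht, fun hc => absurd hid hc, fun _ _ => h1⟩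
    · refine ⟨0, Submodule.zero_mem _, fun _ => rfl, fun _ _ => ?_⟩
      have h0 := (hu v hv).2 hid
      refine ⟨fun a ha => h.flipA_mem_of_not_identified hv hD hid ?_,
        fun b hb => h.flipB_mem_of_not_identified hv hD hid ?_⟩
      · rwa [h0, Prod.fst_zero, add_zero, add_zero] at ha
      · rwa [h0, Prod.snd_zero, add_zero, add_zero] at hb
  · exact ⟨0, Submodule.zero_mem _, fun _ => rfl, fun h1 h2 => absurd ⟨h1, h2⟩ hv⟩

end Setting

/-- The neighbours of the vertices of `Y`. -/
def neighbours (A B : Finset G) (Y : Finset (Vertex G)) : Finset (Vertex G) :=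
  Y.biUnion fun v => univ.image (fun a : A => flipA a v) ∪ univ.image (fun b : B => flipB b v)

lemma card_neighbours_le (hA : #A = D) (hB : #B = D) (Y : Finset (Vertex G)) :
    #(neighbours A B Y) ≤ #Y * (2 * D) := by
  refine card_biUnion_le_card_mul _ _ _ fun v _ => (card_union_le _ _).trans ?_
  have h1 := card_image_le (s := (univ : Finset A)) (f := fun a : A => flipA a v)
  have h2 := card_image_le (s := (univ : Finset B)) (f := fun b : B => flipB b v)
  rw [card_univ, Fintype.card_coe] at h1 h2
  omega

lemma exists_row_or_col_ne_zero {r c : Matrix A B (ZMod 2)} (h : r + c ≠ 0) :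
    (∃ a, r a ≠ 0) ∨ ∃ b, cᵀ b ≠ 0 := by
  by_contra! hc
  refine h ?_
  ext a b
  have h1 : r a b = 0 := congrFun (hc.1 a) b
  have h2 : c a b = 0 := congrFun (hc.2 b) a
  rw [Matrix.add_apply, h1, h2, add_zero]
  rfl

/-- If the rows and columns surviving an update of `V₁` outside `X` all lead to `Y`, then the new
active vertices lie in `Y` or next to `X`. -/
lemma Quadruple.active_update_subset {X Y : Finset (Vertex G)}
    {u : Vertex G → Matrix A B (ZMod 2) × Matrix A B (ZMod 2)}
    (hu : ∀ v ∈ V1 G, v ∉ X → (∀ a, (Z.rowsAt v + (u v).1) a ≠ 0 → flipA a v ∈ Y) ∧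
      ∀ b, (Z.colsAt v + (u v).2)ᵀ b ≠ 0 → flipB b v ∈ Y) :
    (Z.update u).active ⊆ Y ∪ neighbours A B X := by
  intro v hv
  obtain ⟨hv0, hne⟩ := Quadruple.mem_active.1 hv
  rcases exists_row_or_col_ne_zero hne with ⟨a, ha⟩ | ⟨b, hb⟩
  · have hv1 : flipA a v ∈ V1 G := flipA_mem_V1.2 hv0
    by_cases hD : flipA a v ∈ X
    · refine mem_union_right _ (mem_biUnion.2 ⟨_, hD, mem_union_left _ ?_⟩)
      exact mem_image.2 ⟨a, mem_univ _, flipA_flipA a v⟩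
    · refine mem_union_left _ ?_
      rw [← (Z.update u).rowsAt_flipA, Z.rowsAt_update u hv1] at ha
      have := (hu _ hv1 hD).1 a ha
      rwa [flipA_flipA] at this
  · have hv1 : flipB b v ∈ V1 G := flipB_mem_V1.2 hv0
    by_cases hD : flipB b v ∈ X
    · refine mem_union_right _ (mem_biUnion.2 ⟨_, hD, mem_union_right _ ?_⟩)
      exact mem_image.2 ⟨b, mem_univ _, flipB_flipB b v⟩
    · refine mem_union_left _ ?_
      rw [← (Z.update u).colsAt_transpose_flipB, Z.colsAt_update u hv1] at hb
      have := (hu _ hv1 hD).2 b hb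
      rwa [flipB_flipB] at this

end Decoding

/-! ### Cardinality estimates -/

section Bounds

variable {G : Type*} [Group G] [Fintype G] [DecidableEq G] {A B : Finset G} {Δ : ℕ}

lemma card_V0 : #(V0 G) = 2 * Fintype.card G := by
  rw [card_eq_sum_card_parts, Fintype.sum_prod_type]
  simp [V0, Fin.sum_univ_two]
  ring

lemma card_crowded_mul_sq_le (hA : #A = Δ) (hB : #B = Δ) (hinvA : ∀ a ∈ A, a⁻¹ ∈ A)
    (hinvB : ∀ b ∈ B, b⁻¹ ∈ B) (hL : NonbipartiteRamanujan (leftCay A) Δ)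
    (hR : NonbipartiteRamanujan (rightCay B) Δ) {Y : Finset (Vertex G)} {m : ℝ} (hm : 0 ≤ m)
    (hY : Δ * #Y ≤ m / 2 * Fintype.card G) :
    #(crowded A B m Y) * m ^ 2 ≤ 32 * Δ * #Y := by
  classical
  let X₁ : Finset (Vertex G) := univ.filter fun v => m ≤ #{a : A | flipA a v ∈ Y}
  let X₂ : Finset (Vertex G) := univ.filter fun v => m ≤ #{b : B | flipB b v ∈ Y}
  have h1 := card_mul_sq_le_of_flipA hA hinvA hL hm (X := X₁)
    (fun v hv => (mem_filter.1 hv).2) hY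
  have h2 := card_mul_sq_le_of_flipB hB hinvB hR hm (X := X₂)
    (fun v hv => (mem_filter.1 hv).2) hY
  have h3 : #(crowded A B m Y) ≤ #X₁ + #X₂ := by
    refine le_trans (card_le_card fun v hv => ?_) (card_union_le _ _)
    rw [mem_union, mem_filter, mem_filter]
    exact (mem_crowded.1 hv).imp (fun h => ⟨mem_univ _, h⟩) fun h => ⟨mem_univ _, h⟩
  have h4 : (#(crowded A B m Y) : ℝ) ≤ #X₁ + #X₂ := by exact_mod_cast h3
  nlinarith [mul_le_mul_of_nonneg_right h4 (sq_nonneg m)]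

end Bounds

/-! ### Asymptotics -/

open Filter Topology

section Asymptotics

/-- The conditions on the degree `D` (with `s = D ^ (1/2 - ε)` and `P = D ^ (1 - ε)`) under which
all estimates hold. -/
structure LargeDegree (δ D s P : ℝ) : Prop where
  two_le : 2 ≤ D
  le_D : 64 ≤ δ * D
  sixteen_le : 16 ≤ s
  le_P : δ ≤ P
  P_le : P ≤ δ * D / 64
  s_le : s ≤ δ ^ 2 * D / 128
  s_le' : s ≤ δ * D / 8

lemma eventually_rpow_le_mul {x c : ℝ} (hx : x < 1) (hc : 0 < c) :
    ∀ᶠ D : ℝ in atTop, D ^ x ≤ c * D := by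
  have h1 : Tendsto (fun D : ℝ => D ^ (-(1 - x))) atTop (𝓝 0) :=
    tendsto_rpow_neg_atTop (by linarith)
  filter_upwards [h1.eventually_le_const hc, eventually_gt_atTop 0] with D hD hpos
  calc D ^ x = D ^ (-(1 - x)) * D := by
        rw [← Real.rpow_add_one hpos.ne']; congr 1; ring
    _ ≤ c * D := mul_le_mul_of_nonneg_right hD hpos.le

lemma eventually_largeDegree {δ ε : ℝ} (hδ : 0 < δ) (h0 : 0 < ε) (h1 : ε < 1 / 4) :
    ∀ᶠ D : ℝ in atTop, LargeDegree δ D (D ^ (1 / 2 - ε)) (D ^ (1 - ε)) := by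
  have hs : Tendsto (fun D : ℝ => D ^ (1 / 2 - ε)) atTop atTop :=
    tendsto_rpow_atTop (by linarith)
  have hP : Tendsto (fun D : ℝ => D ^ (1 - ε)) atTop atTop := tendsto_rpow_atTop (by linarith)
  filter_upwards [eventually_ge_atTop 2, eventually_ge_atTop (64 / δ), hs.eventually_ge_atTop 16,
    hP.eventually_ge_atTop δ,
    eventually_rpow_le_mul (x := 1 - ε) (by linarith) (by positivity : 0 < δ / 64),
    eventually_rpow_le_mul (x := 1 / 2 - ε) (by linarith) (by positivity : 0 < δ ^ 2 / 128),
    eventually_rpow_le_mul (x := 1 / 2 - ε) (by linarith) (by positivity : 0 < δ / 8)]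
    with D h2 h3 h4 h5 h6 h7 h8
  refine ⟨h2, ?_, h4, h5, by linarith, by linarith, by linarith⟩
  rwa [div_le_iff₀' hδ] at h3

lemma LargeDegree.scales {δ D s P : ℝ} (h : LargeDegree δ D s P) (hδ : 0 < δ) (hδ1 : δ ≤ 1) :
    Scales D (δ * D) (D * s) P (s / 8) := by
  have hD : 0 < D := by linarith [h.two_le]
  have hs : 0 < s := by linarith [h.sixteen_le]
  have hd : 0 < δ * D := by positivity
  have h1 : δ * D / 2 ≤ δ * D - P := by linarith [h.P_le]
  refine ⟨hd, by positivity, by linarith [h.le_P], by positivity, h.P_le, ?_, ?_, ?_, ?_⟩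
  · rw [div_le_iff₀ (by linarith)]
    calc D * s ≤ D * (δ ^ 2 * D / 128) := mul_le_mul_of_nonneg_left h.s_le hD.le
      _ = δ * D / 64 * (δ * D / 2) := by ring
      _ ≤ δ * D / 64 * (δ * D - P) := mul_le_mul_of_nonneg_left h1 (by positivity)
  · linarith [h.s_le']
  · have : δ * (D * s) ≤ 1 * (D * s) := mul_le_mul_of_nonneg_right hδ1 (by positivity)
    have h2 : 0 ≤ D * s := by positivity
    linarith
  · linarith

/-- Combination of the cardinality estimates: `S` active vertices, `E` exceptional ones, `T`
vertices with many active neighbours, `Q` with many exceptional neighbours, and `F` with many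
neighbours among the `T`. -/
lemma combined_bound {δ D s P X S E T Q F : ℝ} (hδ : 0 < δ) (hD : 0 < D) (hs : 0 < s)
    (hP : 0 < P) (hX : 0 < X) (hS : 0 ≤ S) (hX1 : X ≤ s ^ 2) (hX2 : X * D ^ 2 ≤ P ^ 2 * s ^ 2)
    (hX3 : X ≤ D ^ 2) (hE : E * (δ * D * (s / 8) / 4) ^ 2 ≤ 64 * D ^ 2 * S)
    (hT : T * (δ * D / 4) ^ 2 ≤ 32 * D * S) (hQ : Q * (P / 2) ^ 2 ≤ 32 * D * E)
    (hF : F * (δ * D / 16) ^ 2 ≤ 32 * D * T) :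
    E + F + Q * (2 * D) ≤
      (65536 / δ ^ 2 + 4194304 / δ ^ 4 + 16777216 / δ ^ 2) * S / X := by
  have hE' : E ≤ 65536 / δ ^ 2 * S / s ^ 2 := by
    rw [le_div_iff₀ (by positivity), div_mul_eq_mul_div, le_div_iff₀ (by positivity)]
    refine le_of_mul_le_mul_right ?_ (by positivity : 0 < D ^ 2 / 1024)
    linarith
  have hT' : T ≤ 512 / δ ^ 2 * S / D := by
    rw [le_div_iff₀ hD, div_mul_eq_mul_div, le_div_iff₀ (by positivity)]
    refine le_of_mul_le_mul_right ?_ (by positivity : 0 < D / 16)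
    linarith
  have hQ' : Q ≤ 128 * D / P ^ 2 * E := by
    rw [div_mul_eq_mul_div, le_div_iff₀ (by positivity)]
    linarith
  have hF' : F ≤ 8192 / (δ ^ 2 * D) * T := by
    rw [div_mul_eq_mul_div, le_div_iff₀ (by positivity)]
    refine le_of_mul_le_mul_right ?_ (by positivity : 0 < D / 256)
    linarith
  have h1 : E ≤ 65536 / δ ^ 2 * S / X :=
    hE'.trans (div_le_div_of_nonneg_left (by positivity) hX hX1)
  have h2 : F ≤ 4194304 / δ ^ 4 * S / X := by
    calc F ≤ 8192 / (δ ^ 2 * D) * (512 / δ ^ 2 * S / D) :=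
          hF'.trans (mul_le_mul_of_nonneg_left hT' (by positivity))
      _ = 4194304 / δ ^ 4 * S / D ^ 2 := by field_simp; ring
      _ ≤ 4194304 / δ ^ 4 * S / X := div_le_div_of_nonneg_left (by positivity) hX hX3
  have h3 : Q * (2 * D) ≤ 16777216 / δ ^ 2 * S / X := by
    calc Q * (2 * D) ≤ 128 * D / P ^ 2 * (65536 / δ ^ 2 * S / s ^ 2) * (2 * D) :=
          mul_le_mul_of_nonneg_right (hQ'.trans (mul_le_mul_of_nonneg_left hE' (by positivity)))
            (by positivity)
      _ = 16777216 / δ ^ 2 * S * (D ^ 2 / (P ^ 2 * s ^ 2)) := by field_simp; ring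
      _ ≤ 16777216 / δ ^ 2 * S * (1 / X) := by
          refine mul_le_mul_of_nonneg_left ?_ (by positivity)
          rw [div_le_div_iff₀ (by positivity) hX]
          linarith
      _ = 16777216 / δ ^ 2 * S / X := by ring
  calc E + F + Q * (2 * D) ≤ 65536 / δ ^ 2 * S / X + 4194304 / δ ^ 4 * S / X +
        16777216 / δ ^ 2 * S / X := by linarith
    _ = _ := by ring

end Asymptotics

/-! ### Combination of the estimates -/

section Main

variable {G : Type*} [Group G] [Fintype G] [DecidableEq G] {A B : Finset G}
  {CA : Submodule (ZMod 2) (A → ZMod 2)} {CB : Submodule (ZMod 2) (B → ZMod 2)}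
  {z : Square A B → ZMod 2} {Z : Quadruple A B} {Δ : ℕ} {δ s P : ℝ}

/-- The cardinality estimates for the sets of atypical vertices, from the expansion of the two
Cayley graphs and of their product. -/
lemma card_atypical_le (hδ : 0 < δ) (hlarge : LargeDegree δ Δ s P)
    (h : Setting Δ (δ * Δ) (Δ * s) P (s / 8) CA CB z Z)
    (hinvA : ∀ a ∈ A, a⁻¹ ∈ A) (hinvB : ∀ b ∈ B, b⁻¹ ∈ B)
    (hL : NonbipartiteRamanujan (leftCay A) Δ) (hR : NonbipartiteRamanujan (rightCay B) Δ)
    (hS : (#Z.active : ℝ) ≤ δ / (8 * Δ) * #(V0 G)) {X : ℝ} (hX : 0 < X) (hX1 : X ≤ s ^ 2)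
    (hX2 : X * Δ ^ 2 ≤ P ^ 2 * s ^ 2) (hX3 : X ≤ Δ ^ 2) :
    (#(Z.exceptional (δ * Δ * (s / 8) / 2)) +
      #(crowded A B (δ * Δ / 16) (crowded A B (δ * Δ / 4) Z.active)) +
      #(crowded A B (P / 2) (Z.exceptional (δ * Δ * (s / 8) / 2))) * (2 * Δ) : ℝ) ≤
      (65536 / δ ^ 2 + 4194304 / δ ^ 4 + 16777216 / δ ^ 2) * #Z.active / X := by
  have hD : (0 : ℝ) < Δ := by linarith [hlarge.two_le]
  have hs : 0 < s := by linarith [hlarge.sixteen_le]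
  have hP : 0 < P := by linarith [hlarge.le_P]
  set n : ℝ := ((Fintype.card G : ℕ) : ℝ) with hn
  have hn0 : 0 ≤ n := Nat.cast_nonneg _
  have hSn : Δ * (#Z.active : ℝ) ≤ δ / 4 * n := by
    rw [card_V0] at hS
    push_cast at hS
    calc Δ * (#Z.active : ℝ) ≤ Δ * (δ / (8 * Δ) * (2 * n)) := mul_le_mul_of_nonneg_left hS hD.le
      _ = δ / 4 * n := by field_simp; ring
  have hES : (#(Z.exceptional (δ * Δ * (s / 8) / 2)) : ℝ) ≤ #Z.active := by
    exact_mod_cast card_le_card (Z.exceptional_subset _)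
  have hE := card_mul_sq_le_of_opposite h.card_A h.card_B hinvA hinvB hL hR
    (m := δ * Δ * (s / 8) / 4) (by positivity) (fun v hv => h.le_card_opposite hv) (by
      calc (Δ : ℝ) ^ 2 * #Z.active = Δ * (Δ * #Z.active) := by ring
        _ ≤ Δ * (δ / 4 * n) := mul_le_mul_of_nonneg_left hSn hD.le
        _ = 16 * (δ * Δ * n / 64) := by ring
        _ ≤ s * (δ * Δ * n / 64) := mul_le_mul_of_nonneg_right hlarge.sixteen_le (by positivity)
        _ = δ * Δ * (s / 8) / 4 / 2 * n := by ring)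
  have hT := card_crowded_mul_sq_le h.card_A h.card_B hinvA hinvB hL hR
    (m := δ * Δ / 4) (Y := Z.active) (by positivity) (by
      calc Δ * (#Z.active : ℝ) ≤ δ / 4 * n := hSn
        _ = 2 * (δ * n / 8) := by ring
        _ ≤ Δ * (δ * n / 8) := mul_le_mul_of_nonneg_right hlarge.two_le (by positivity)
        _ = δ * Δ / 4 / 2 * n := by ring)
  have hQ := card_crowded_mul_sq_le h.card_A h.card_B hinvA hinvB hL hR
    (m := P / 2) (Y := Z.exceptional (δ * Δ * (s / 8) / 2)) (by positivity) (by
      calc Δ * (#(Z.exceptional (δ * Δ * (s / 8) / 2)) : ℝ) ≤ Δ * #Z.active :=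
            mul_le_mul_of_nonneg_left hES hD.le
        _ ≤ δ / 4 * n := hSn
        _ ≤ P / 2 / 2 * n := mul_le_mul_of_nonneg_right (by linarith [hlarge.le_P]) hn0)
  have hF := card_crowded_mul_sq_le h.card_A h.card_B hinvA hinvB hL hR
    (m := δ * Δ / 16) (Y := crowded A B (δ * Δ / 4) Z.active) (by positivity) (by
      have h1 : (Δ * #(crowded A B (δ * Δ / 4) Z.active) : ℝ) * (δ ^ 2 * Δ / 512) ≤
          δ / 4 * n := by linarith
      refine le_of_mul_le_mul_right (h1.trans ?_) (by positivity : 0 < δ ^ 2 * (Δ : ℝ) / 512)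
      calc δ / 4 * n = 64 ^ 2 * (δ * n / 16384) := by ring
        _ ≤ (δ * Δ) ^ 2 * (δ * n / 16384) := mul_le_mul_of_nonneg_right
            (pow_le_pow_left₀ (by norm_num) hlarge.le_D 2) (by positivity)
        _ = δ * Δ / 16 / 2 * n * (δ ^ 2 * Δ / 512) := by ring)
  exact combined_bound hδ hD hs hP hX (Nat.cast_nonneg _) hX1 hX2 hX3 hE hT hQ hF

end Main

end QTanner

theorem theorem3 (δ : ℝ) (hδ : 0 < δ) :
    ∃ κ : ℝ, 0 < κ ∧
    ∀ ρ ε : ℝ, 0 < ρ → ρ < 1 / 2 → 0 < ε → ε < 1 / 4 →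
    ∃ Δ₀ : ℕ, ∀ Δ : ℕ, Δ₀ ≤ Δ →
    ∀ (G : Type*) [Group G] [Fintype G] [DecidableEq G] (A B : Finset G),
      A.card = Δ → B.card = Δ →
      (∀ a ∈ A, a⁻¹ ∈ A) → (∀ b ∈ B, b⁻¹ ∈ B) →
      QTanner.NonbipartiteRamanujan (QTanner.leftCay A) Δ →
      QTanner.NonbipartiteRamanujan (QTanner.rightCay B) Δ →
    ∀ (CA : Submodule (ZMod 2) (A → ZMod 2)) (CB : Submodule (ZMod 2) (B → ZMod 2)),
      QTanner.GoodCodes Δ ρ δ ε CA CB →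
    ∀ (z : QTanner.Square A B → ZMod 2) (Z : QTanner.Quadruple A B),
      QTanner.Stalled CA CB z →
      Z.IsMinimal CA CB z →
      (Z.active.card : ℝ) ≤ δ / (8 * Δ) * ((QTanner.V0 G).card : ℝ) →
    ∀ u : QTanner.Vertex G → Matrix A B (ZMod 2) × Matrix A B (ZMod 2),
      QTanner.FirstParallelStep ((Δ : ℝ) ^ (3 / 2 - ε)) ((Δ : ℝ) ^ (1 - ε)) CA CB z u →
    ∃ t : QTanner.Vertex G → Matrix A B (ZMod 2),
      (∀ v, t v ∈ QTanner.tensorCode CA CB) ∧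
      (∀ v, ¬ QTanner.Identified ((Δ : ℝ) ^ (3 / 2 - ε)) ((Δ : ℝ) ^ (1 - ε)) CA CB
        (QTanner.localView v z) → t v = 0) ∧
      ((Z.update fun v => ((u v).1 + t v, (u v).2 + t v)).active.card : ℝ) ≤
        κ * (Z.active.card : ℝ) / (Δ : ℝ) ^ (1 - 4 * ε) := by
  refine ⟨65536 / δ ^ 2 + 4194304 / δ ^ 4 + 16777216 / δ ^ 2, by positivity, ?_⟩
  intro ρ ε _ _ hε0 hε1
  obtain ⟨Δ₀, hΔ₀⟩ := Filter.eventually_atTop.1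
    (tendsto_natCast_atTop_atTop.eventually (QTanner.eventually_largeDegree hδ hε0 hε1))
  refine ⟨Δ₀, fun Δ hΔ G _ _ _ A B hA hB hinvA hinvB hL hR CA CB hC z Z hst hmin hS u hu => ?_⟩
  have hlarge := hΔ₀ Δ hΔ
  have hD : (0 : ℝ) < Δ := by linarith [hlarge.two_le]
  have hD1 : (1 : ℝ) ≤ Δ := by linarith [hlarge.two_le]
  -- A minimum distance is at most the length `Δ`.
  have hδ1 : δ ≤ 1 := by
    have h1 : (QTanner.minDist CA : ℝ) ≤ Δ := by
      have := QTanner.minDist_le_card (C := CA)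
      rw [Fintype.card_coe, hA] at this
      exact_mod_cast this
    have h2 := hC.dist_A.trans h1
    exact le_of_mul_le_mul_right (by linarith) hD
  have hw : (Δ : ℝ) ^ (3 / 2 - ε) = Δ * (Δ : ℝ) ^ (1 / 2 - ε) := by
    rw [mul_comm, ← Real.rpow_add_one hD.ne']
    congr 1
    ring
  have hrob := hC.robust_one
  rw [hw] at hu hrob ⊢
  have hset : QTanner.Setting Δ (δ * Δ) (Δ * (Δ : ℝ) ^ (1 / 2 - ε)) ((Δ : ℝ) ^ (1 - ε))
      ((Δ : ℝ) ^ (1 / 2 - ε) / 8) CA CB z Z :=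
    ⟨hlarge.scales hδ hδ1, hA, hB, hC.dist_A, hC.dist_B, hrob, hst, hmin⟩
  choose t ht ht0 htu using hset.exists_tensor hu
  refine ⟨t, ht, ht0, ?_⟩
  have hsub := Finset.card_le_card (QTanner.Quadruple.active_update_subset
    (u := fun v => ((u v).1 + t v, (u v).2 + t v)) htu)
  have hcard := hsub.trans ((Finset.card_union_le _ _).trans
    (add_le_add (Finset.card_union_le _ _) (QTanner.card_neighbours_le hA hB _)))
  refine le_trans (by exact_mod_cast hcard) (QTanner.card_atypical_le hδ hlarge hset hinvA hinvB
    hL hR hS (Real.rpow_pos_of_pos hD _) ?_ ?_ ?_)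
  · rw [← Real.rpow_natCast, ← Real.rpow_mul hD.le]
    exact Real.rpow_le_rpow_of_exponent_le hD1 (by push_cast; linarith)
  · refine le_of_eq ?_
    rw [← Real.rpow_natCast, ← Real.rpow_natCast, ← Real.rpow_natCast, ← Real.rpow_mul hD.le,
      ← Real.rpow_mul hD.le, ← Real.rpow_add hD, ← Real.rpow_add hD]
    congr 1
    push_cast
    ring
  · rw [← Real.rpow_natCast]
    exact Real.rpow_le_rpow_of_exponent_le hD1 (by push_cast; linarith)
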